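/- Fix an integer $e\ge 2$ and an integer $m$ with $0\le m<e$. Let $W$ be the Weyl group of type $A^{(1)}_{e-1}$, i.e. the Coxeter group with simple reflections $s_i$ ($i\in\mathbb Z/e\mathbb Z$), where $s_is_{i+1}$ has order $3$ (infinite order if $e=2$) and non-adjacent $s_i,s_j$ commute. For $c\in\mathbb Z/e\mathbb Z$ let $W_c=\langle s_i\mid i\ne c\rangle$, let $W/W_c\subset W$ denote the set of minimal length representatives of the cosets $wW_c$, and let $w_0$ be the longest element of $W_0$. Write $\le$ for the Bruhat order on $W$. For $c\in\{0,\dots,e-1\}$ let $B(\Lambda_c)$ be the crystal of the fundamental weight $\Lambda_c$, realized on the partitions $\lambda=(\lambda_0\ge\lambda_1\ge\cdots)$ with $\lambda_k-\lambda_{k+1}<e$ for all $k$ ($e$-restricted partitions). The node in row $a$ and column $b$ (numbered from $0$) has residue $c-a+b \bmod e$, and $wt(\lambda)=\Lambda_c-\sum_i N_i(\lambda)\alpha_i$, where $N_i(\lambda)$ is the number of nodes of residue $i$. To compute $\tilde f_i\lambda$ and $\tilde e_i\lambda$, read the addable ($A$) and removable ($R$) nodes of residue $i$ from the first row to the last and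 repeatedly delete adjacent pairs $RA$, until a sequence $A\cdots AR\cdots R$ is left; $\tilde f_i$ adds the node of the rightmost $A$ and $\tilde e_i$ removes the node of the leftmost $R$ (the result is $0$ if there is none). The group $W$ acts on $B(\Lambda_c)$ by $s_ib=\tilde f_i^{\,wt(b)(h_i)}b$ if $wt(b)(h_i)\ge 0$ and $s_ib=\tilde e_i^{\,-wt(b)(h_i)}b$ otherwise. Let $\emptyset_c\in B(\Lambda_c)$ be the empty partition; its $W$-orbit is the set of $e$-cores in $B(\Lambda_c)$. The set of beta numbers of charge $c$ of a partition $\lambda$ is $\{\lambda_k+c-k\mid k\ge 0\}$. For an $e$-core $\lambda\in B(\Lambda_0)$ with set $J$ of beta numbers of charge $0$, put $M_i=\max\{x\in J\mid x+e\mathbb Z=i\}$ for $i\in\mathbb Z/e\mathbb Z$, write these numbers in descending order $M_{i_1}>M_{i_2}>\cdots>M_{i_e}$, and let $\tau_m(\lambda)\in B(\Lambda_m)$ be the partition whose set of beta numbers of charge $m$ is $J\cup\{M_{i_k}+e\mid 1\le k\le m\}$. Proposition. Let $\lambda=w\emptyset_0\in B(\Lambda_0)$ with $w\in W/W_0$,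 and let $\mu=w'\emptyset_m\in B(\Lambda_m)$ with $w'\in W/W_m$. Then $\tau_m(\lambda)$ is well defined and $e$-restricted; $$ww_0\ge w'\quad\text{if and only if}\quad\tau_m(\lambda)\supset\mu;$$ and moreover $ww_0\emptyset_m=\tau_m(\lambda)$. -/

import Mathlib

namespace AffineCrystal

/-! ### Partitions, residues, the signature rule and the crystal operators

Partitions are Young diagrams, with rows and columns numbered from `0`; `lam.rowLen k` is the
`k`-th part.  The charge is an integer `m` and colours live in `ZMod e`.  The crystal
`B(Λ_m)` is the set of `e`-restricted partitions; the operators below are given on all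
partitions by the same formulas. -/

/-- A partition is `e`-restricted if consecutive parts differ by less than `e`. -/
def IsRestricted (e : ℕ) (lam : YoungDiagram) : Prop :=
  ∀ k : ℕ, lam.rowLen k < lam.rowLen (k + 1) + e

/-- The residue of the node in row `x.1` and column `x.2`: its content `m - x.1 + x.2` mod `e`. -/
def residue (e : ℕ) (m : ℤ) (x : ℕ × ℕ) : ZMod e :=
  ((m - (x.1 : ℤ) + (x.2 : ℤ) : ℤ) : ZMod e)

/-- `x` can be added to `lam` so that the result is again a partition. -/
def IsAddable (lam : YoungDiagram) (x : ℕ × ℕ) : Prop :=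
  x ∉ lam.cells ∧ IsLowerSet ((insert x lam.cells : Finset (ℕ × ℕ)) : Set (ℕ × ℕ))

/-- `x` can be removed from `lam` so that the result is again a partition. -/
def IsRemovable (lam : YoungDiagram) (x : ℕ × ℕ) : Prop :=
  x ∈ lam.cells ∧ IsLowerSet ((lam.cells.erase x : Finset (ℕ × ℕ)) : Set (ℕ × ℕ))

open scoped Classical in
/-- Add the node `x`; the value `none` stands for the element `0` adjoined to the crystal. -/
noncomputable def addNode (lam : YoungDiagram) (x : ℕ × ℕ) : Option YoungDiagram :=
  if h : IsAddable lam x then some ⟨insert x lam.cells, h.2⟩ else none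

open scoped Classical in
/-- Remove the node `x`; the value `none` stands for the element `0` adjoined to the crystal. -/
noncomputable def removeNode (lam : YoungDiagram) (x : ℕ × ℕ) : Option YoungDiagram :=
  if h : IsRemovable lam x then some ⟨lam.cells.erase x, h.2⟩ else none

/-- A letter of the signature: an addable node `A x` or a removable node `R x`. -/
inductive Letter where
  | A (x : ℕ × ℕ) : Letter
  | R (x : ℕ × ℕ) : Letter

open scoped Classical in
/-- The letters contributed by row `k` to the `i`-signature.  The only node of row `k` that may be
addable is `(k, lam.rowLen k)`, the only one that may be removable is `(k, lam.rowLen k - 1)`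
(an empty row has no removable node, as then `(k, 0)` is not a node). -/
noncomputable def rowLetters (e : ℕ) (m : ℤ) (i : ZMod e) (lam : YoungDiagram) (k : ℕ) :
    List Letter :=
  (if IsAddable lam (k, lam.rowLen k) ∧ residue e m (k, lam.rowLen k) = i
    then [Letter.A (k, lam.rowLen k)] else []) ++
  (if IsRemovable lam (k, lam.rowLen k - 1) ∧ residue e m (k, lam.rowLen k - 1) = i
    then [Letter.R (k, lam.rowLen k - 1)] else [])

/-- The `i`-signature: the addable and removable `i`-nodes, read from the first row to the last
(rows below row `lam.colLen 0` have neither). -/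
noncomputable def signature (e : ℕ) (m : ℤ) (i : ZMod e) (lam : YoungDiagram) : List Letter :=
  (List.range (lam.colLen 0 + 1)).flatMap (rowLetters e m i lam)

/-- Put a letter in front of a completely reduced sequence `A…AR…R` and delete the adjacent pair
`RA`, if one arises. -/
def raCons : Letter → List Letter → List Letter
  | Letter.R _, Letter.A _ :: l => l
  | x, l => x :: l

/-- `RA`-deletion: delete adjacent pairs `RA` as long as there are any. -/
def raDeletion (l : List Letter) : List Letter := l.foldr raCons []

/-- The addable normal `i`-nodes, from the first row to the last. -/
noncomputable def addableNormal (e : ℕ) (m : ℤ) (i : ZMod e) (lam : YoungDiagram) :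
    List (ℕ × ℕ) :=
  (raDeletion (signature e m i lam)).filterMap fun
    | Letter.A x => some x
    | Letter.R _ => none

/-- The removable normal `i`-nodes, from the first row to the last. -/
noncomputable def removableNormal (e : ℕ) (m : ℤ) (i : ZMod e) (lam : YoungDiagram) :
    List (ℕ × ℕ) :=
  (raDeletion (signature e m i lam)).filterMap fun
    | Letter.A _ => none
    | Letter.R x => some x

/-- The Kashiwara operator `f̃_i` on partitions together with `0 = none`: it adds the node of the
rightmost `A` of the reduced signature. -/
noncomputable def fTilde (e : ℕ) (m : ℤ) (i : ZMod e) (b : Option YoungDiagram) :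
    Option YoungDiagram :=
  b.bind fun lam => (addableNormal e m i lam).getLast?.bind (addNode lam)

/-- The Kashiwara operator `ẽ_i` on partitions together with `0 = none`: it removes the node of
the leftmost `R` of the reduced signature. -/
noncomputable def eTilde (e : ℕ) (m : ℤ) (i : ZMod e) (b : Option YoungDiagram) :
    Option YoungDiagram :=
  b.bind fun lam => (removableNormal e m i lam).head?.bind (removeNode lam)

/-- The entry `α_j(h_i)` of the generalized Cartan matrix of type `A^{(1)}_{e-1}` (for `e = 2` the
off-diagonal entries are `-2`). -/
def cartan (e : ℕ) (i j : ZMod e) : ℤ :=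
  (if j = i then 2 else 0) - (if j = i + 1 then 1 else 0) - (if j = i - 1 then 1 else 0)

/-- The integer `wt(lam)(h_i)`, where `wt(lam) = Λ_m - ∑_j N_j(lam) α_j`, with `N_j(lam)` the number
of nodes of residue `j`, and `Λ_m(h_i) = δ_{im}`: every node `x` contributes `-α_{res x}`. -/
def wtPairing (e : ℕ) (m : ℤ) (lam : YoungDiagram) (i : ZMod e) : ℤ :=
  (if i = (m : ZMod e) then 1 else 0) - ∑ x ∈ lam.cells, cartan e i (residue e m x)

/-! ### The affine Weyl group and its action on the crystal -/

/-- The Coxeter matrix of type `A^{(1)}_{e-1}`, indexed by `ZMod e`: neighbours `i`, `i + 1` satisfy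
the braid relation of order `3` if `e ≥ 3`, and no relation (entry `0`) if `e = 2`. -/
def coxeterMatrix (e : ℕ) : CoxeterMatrix (ZMod e) where
  M := Matrix.of fun i j =>
    if i = j then 1
    else if j = i + 1 ∨ i = j + 1 then (if e = 2 then 0 else 3)
    else 2
  isSymm := by
    ext i j
    simp only [Matrix.transpose_apply, Matrix.of_apply, eq_comm (a := j) (b := i),
      or_comm (a := i = j + 1)]
  diagonal i := by simp
  off_diagonal i j h := by
    simp only [Matrix.of_apply, if_neg h]
    split_ifs <;> norm_num

/-- The Weyl group `W` of type `A^{(1)}_{e-1}`. -/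
abbrev Weyl (e : ℕ) : Type := (coxeterMatrix e).Group

/-- `W` with its simple reflections `s_i`, `i ∈ ZMod e`, as a Coxeter system. -/
abbrev coxeterSystem (e : ℕ) : CoxeterSystem (coxeterMatrix e) (Weyl e) :=
  (coxeterMatrix e).toCoxeterSystem

/-- The Bruhat order on `W`: `u ≤ v` if `v` is reached from `u` by multiplying successively by
reflections, the length increasing at every step. -/
def BruhatLE (e : ℕ) : Weyl e → Weyl e → Prop :=
  Relation.ReflTransGen fun u v =>
    ∃ t, (coxeterSystem e).IsReflection t ∧ v = u * t ∧
      (coxeterSystem e).length u < (coxeterSystem e).length v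

/-- The subgroup `W_c` of `W` generated by the `s_i` with `i ≠ c`. -/
def parabolic (e : ℕ) (c : ZMod e) : Subgroup (Weyl e) :=
  Subgroup.closure {x | ∃ i : ZMod e, i ≠ c ∧ x = (coxeterSystem e).simple i}

/-- `w` is the distinguished (minimal length) representative of its coset `w W_c`. -/
def IsDistinguished (e : ℕ) (c : ZMod e) (w : Weyl e) : Prop :=
  ∀ u ∈ parabolic e c, (coxeterSystem e).length w ≤ (coxeterSystem e).length (w * u)

/-- `w` is the longest element of `W_c`. -/
def IsLongest (e : ℕ) (c : ZMod e) (w : Weyl e) : Prop :=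
  w ∈ parabolic e c ∧
    ∀ u ∈ parabolic e c, (coxeterSystem e).length u ≤ (coxeterSystem e).length w

/-- The action of the simple reflection `s_i` on the crystal: `f̃_i` applied `wt(b)(h_i)` times if
this is nonnegative, and `ẽ_i` applied `-wt(b)(h_i)` times otherwise. -/
noncomputable def simpleAct (e : ℕ) (m : ℤ) (i : ZMod e) (b : Option YoungDiagram) :
    Option YoungDiagram :=
  b.bind fun lam =>
    if 0 ≤ wtPairing e m lam i then (fTilde e m i)^[(wtPairing e m lam i).toNat] (some lam)
    else (eTilde e m i)^[(-wtPairing e m lam i).toNat] (some lam)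

/-- The word `i₁ i₂ … i_l` acts as `s_{i₁} (s_{i₂} (… (s_{i_l} b)))`. -/
noncomputable def wordAct (e : ℕ) (m : ℤ) (l : List (ZMod e)) (b : Option YoungDiagram) :
    Option YoungDiagram :=
  l.foldr (simpleAct e m) b

/-- The graph of the action of `W` on partitions of charge `m`: `nu = w lam` if
`nu = s_{i₁} (… (s_{i_l} lam))` for an expression `w = s_{i₁} ⋯ s_{i_l}`. -/
def IsTranslate (e : ℕ) (m : ℤ) (w : Weyl e) (lam nu : YoungDiagram) : Prop :=
  ∃ l : List (ZMod e), (coxeterSystem e).wordProd l = w ∧ wordAct e m l (some lam) = some nu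

/-! ### Beta numbers and the operation `τ_m` -/

/-- The set `J` of beta numbers `lam_k + m - k`, `k ≥ 0`, of charge `m`. -/
def betaSet (m : ℤ) (lam : YoungDiagram) : Set ℤ :=
  Set.range fun k : ℕ => (lam.rowLen k : ℤ) + m - (k : ℤ)

/-- `M_i(J)`, the largest element of `J` on runner `i`, that is, congruent to `i` mod `e` (on sets of
beta numbers every runner is nonempty and bounded above). -/
noncomputable def runnerMax (e : ℕ) (J : Set ℤ) (i : ZMod e) : ℤ :=
  sSup {x : ℤ | x ∈ J ∧ (x : ZMod e) = i}

/-- `J ∪ {M_i(J) + e}`, where `i` runs over the `m` runners with the largest `M_i(J)`, that is, over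
those for which fewer than `m` runners have a larger maximum. -/
def tauSet (e m : ℕ) (J : Set ℤ) : Set ℤ :=
  J ∪ {y : ℤ | ∃ i : ZMod e,
    {j : ZMod e | runnerMax e J i < runnerMax e J j}.ncard < m ∧ y = runnerMax e J i + (e : ℤ)}

open scoped Classical in
/-- `τ_m(lam)`: the partition whose set of beta numbers of charge `m` is `τ_m(J)`, with `J` the set of
beta numbers of charge `0` of `lam` (`lam` an `e`-core). -/
noncomputable def tau (e m : ℕ) (lam : YoungDiagram) : YoungDiagram :=
  if h : ∃ nu : YoungDiagram, betaSet (m : ℤ) nu = tauSet e m (betaSet 0 lam) then h.choose else ⊥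

end AffineCrystal

/-!
The affine Weyl group acts on `ℤ`, the simple reflection `s_i` exchanging `x` and `x + 1` for every
`x` of residue `i` (`affPerm`).  Adding a node of residue `i` to a partition replaces a beta
number `x` of residue `i` by `x + 1`, and the beta numbers of a core are closed under subtraction of `e`.  So a
core never has both addable and removable `i`-nodes, no pair `RA` is ever deleted from its
`i`-signature, and `s_i` acts on the beta numbers by this permutation (`exists_simpleAct`; the
weight is the number of addable minus the number of removable nodes by `wtPairing_eq`).  Hence the beta
numbers of `w ∅_m` are the image `orbitSet m w` of the half line `{x | x ≤ m}` (`isTranslate_iff`).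

The length function is read off from the permutation: `s_i` is an ascent of `w` exactly if
`w x < w (x + 1)` for `x` of residue `i` (`affPerm_lt_iff_length_lt`), by induction on the length
inside the dihedral groups generated by two simple reflections.  It follows that the action on `ℤ` is
faithful, and then that the strong exchange condition (`exists_word_of_inversion`) and the analogous
statement for all reflections hold.

Containment of partitions means that, above every bound, one set of beta numbers has at most as many
elements as the other (`le_iff_dominated`).  A step upwards in the Bruhat order only enlarges these
counts (`BruhatLE.dominated`).  Conversely, if the core of a minimal coset representative `u` is
contained in that of `v`, removing a left descent of `v`, together with the removable nodes of that
residue in the smaller core, keeps the containment, and the lifting property of the Bruhat order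
concludes by induction (`bruhatLE_of_dominated`).

Finally, `w₀` reverses `1, …, e`, so `w₀ {x | x ≤ m} = {x | x ≤ 0} ∪ {e - m + 1, …, e}`.  As `w` is
increasing on `1, …, e`, the highest elements of the runners of `w {x | x ≤ 0}` are
`w 0 > w (-1) > ⋯ > w (1 - e)`, and applying `w` gives exactly the set defining `τ_m`
(`tauSet_orbitSet_eq`).
-/

/-! ### The affine permutations of `ℤ` -/

namespace AffineCrystal

variable {e : ℕ}

/-- The map `ℤ → ℤ` exchanging `x` and `x + 1` for every `x` of residue `i`. -/
def swapFun (i : ZMod e) (x : ℤ) : ℤ :=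
  if (x : ZMod e) = i then x + 1 else if (x : ZMod e) = i + 1 then x - 1 else x

lemma swapFun_of_eq {i : ZMod e} {x : ℤ} (h : (x : ZMod e) = i) : swapFun i x = x + 1 := by
  simp [swapFun, h]

lemma swapFun_of_ne {i : ZMod e} {x : ℤ} (h : (x : ZMod e) ≠ i) (h' : (x : ZMod e) ≠ i + 1) :
    swapFun i x = x := by
  simp [swapFun, h, h']

lemma swapFun_add (i : ZMod e) (x : ℤ) : swapFun i (x + e) = swapFun i x + e := by
  simp only [swapFun, Int.cast_add, Int.cast_natCast, CharP.cast_eq_zero, add_zero]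
  split_ifs <;> ring

lemma exists_eq_add_mul {x y : ℤ} (h : (x : ZMod e) = y) : ∃ k : ℤ, x = y + k * e := by
  rw [ZMod.intCast_eq_intCast_iff_dvd_sub] at h
  obtain ⟨k, hk⟩ := h
  exact ⟨-k, by linarith⟩

/-- The only pairs inverted by `s_i` are the neighbours `x`, `x + 1` with `x` of residue `i`. -/
lemma swapFun_lt_swapFun {i : ZMod e} {a b : ℤ} (hab : a < b) (h : swapFun i b < swapFun i a) :
    b = a + 1 ∧ (a : ZMod e) = i := by
  have hb : b - 1 ≤ swapFun i b := by unfold swapFun; split_ifs <;> omega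
  by_cases ha : (a : ZMod e) = i
  · rw [swapFun_of_eq ha] at h
    exact ⟨by omega, ha⟩
  · have ha' : swapFun i a ≤ a := by unfold swapFun; split_ifs <;> omega
    omega

variable [Fact (1 < e)]

lemma swapFun_of_eq_add_one {i : ZMod e} {x : ℤ} (h : (x : ZMod e) = i + 1) :
    swapFun i x = x - 1 := by
  simp [swapFun, h]

lemma swapFun_swapFun (i : ZMod e) (x : ℤ) : swapFun i (swapFun i x) = x := by
  by_cases h : (x : ZMod e) = i
  · rw [swapFun_of_eq h, swapFun_of_eq_add_one (by simp [h])]; ring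
  by_cases h' : (x : ZMod e) = i + 1
  · rw [swapFun_of_eq_add_one h', swapFun_of_eq (by simp [h'])]; ring
  · rw [swapFun_of_ne h h', swapFun_of_ne h h']

/-- The permutation of `ℤ` exchanging `x` and `x + 1` for every `x` of residue `i`. -/
def swapPerm (i : ZMod e) : Equiv.Perm ℤ :=
  ⟨swapFun i, swapFun i, swapFun_swapFun i, swapFun_swapFun i⟩

@[simp] lemma swapPerm_apply (i : ZMod e) (x : ℤ) : swapPerm i x = swapFun i x := rfl

lemma swapFun_braid {i : ZMod e} (h2 : e ≠ 2) (x : ℤ) :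
    (fun y => swapFun i (swapFun (i + 1) y))^[3] x = x := by
  have hne : i + 1 + 1 ≠ i := by
    intro h
    have h' : ((2 : ℕ) : ZMod e) = 0 := by
      have : i + (1 + 1) = i := by rw [← add_assoc]; exact h
      simpa [one_add_one_eq_two] using this
    rw [ZMod.natCast_eq_zero_iff] at h'
    have := Nat.le_of_dvd two_pos h'
    have := (Fact.out : 1 < e)
    omega
  have up : ∀ y : ℤ, (y : ZMod e) = i → swapFun i (swapFun (i + 1) y) = y + 1 := by
    intro y h
    rw [swapFun_of_ne (i := i + 1) (by simp [h]) (by rw [h]; exact hne.symm), swapFun_of_eq h]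
  have up' : ∀ y : ℤ, (y : ZMod e) = i + 1 → swapFun i (swapFun (i + 1) y) = y + 1 := by
    intro y h
    rw [swapFun_of_eq h, swapFun_of_ne] <;> simp only [Int.cast_add, Int.cast_one, h]
    · exact hne
    · simp
  have dn : ∀ y : ℤ, (y : ZMod e) = i + 1 + 1 → swapFun i (swapFun (i + 1) y) = y - 2 := by
    intro y h
    rw [swapFun_of_eq_add_one h, swapFun_of_eq_add_one (by simp [h])]; ring
  simp only [Function.iterate_succ, Function.iterate_zero, Function.comp_apply, id]
  by_cases h : (x : ZMod e) = i
  · rw [up x h, up' (x + 1) (by simp [h]), dn (x + 1 + 1) (by simp [h])]; ring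
  by_cases h' : (x : ZMod e) = i + 1
  · rw [up' x h', dn (x + 1) (by simp [h']), up _ (by push_cast; rw [h']; ring)]; ring
  by_cases h'' : (x : ZMod e) = i + 1 + 1
  · rw [dn x h'', up (x - 2) (by push_cast; rw [h'']; ring),
      up' (x - 2 + 1) (by push_cast; rw [h'']; ring)]; ring
  · have : swapFun i (swapFun (i + 1) x) = x := by
      rw [swapFun_of_ne h' h'', swapFun_of_ne h h']
    simp [this]

lemma swapFun_comm {i j : ZMod e} (h : j ≠ i + 1) (h' : i ≠ j + 1) (x : ℤ) :
    swapFun i (swapFun j x) = swapFun j (swapFun i x) := by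
  rcases eq_or_ne i j with rfl | hij
  · rfl
  have hij' : i + 1 ≠ j + 1 := fun h => hij (add_right_cancel h)
  by_cases h1 : (x : ZMod e) = i
  · rw [swapFun_of_ne (i := j) (by rwa [h1]) (by rwa [h1]), swapFun_of_eq h1,
      swapFun_of_ne (by simpa [h1] using h.symm) (by simpa [h1] using hij)]
  by_cases h2 : (x : ZMod e) = i + 1
  · rw [swapFun_of_ne (i := j) (by rw [h2]; exact h.symm) (by rwa [h2]), swapFun_of_eq_add_one h2,
      swapFun_of_ne (by simpa [h2] using hij) (by simpa [h2] using h')]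
  rw [swapFun_of_ne h1 h2]
  by_cases h3 : (x : ZMod e) = j
  · rw [swapFun_of_eq h3,
      swapFun_of_ne (by simpa [h3] using h'.symm) (by simpa [h3] using hij.symm)]
  by_cases h4 : (x : ZMod e) = j + 1
  · rw [swapFun_of_eq_add_one h4,
      swapFun_of_ne (by simpa [h4] using hij.symm) (by simpa [h4] using h)]
  rw [swapFun_of_ne h3 h4, swapFun_of_ne h1 h2]

lemma swapPerm_mul_self (i : ZMod e) : swapPerm i * swapPerm i = 1 := by
  ext x; simp [swapFun_swapFun]

lemma swapPerm_braid {i : ZMod e} (h2 : e ≠ 2) : (swapPerm i * swapPerm (i + 1)) ^ 3 = 1 := by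
  ext x
  exact swapFun_braid h2 x

lemma isLiftable_swapPerm : (coxeterMatrix e).IsLiftable (swapPerm (e := e)) := by
  intro i j
  simp only [coxeterMatrix, Matrix.of_apply]
  split_ifs with h1 h2 h3
  · subst h1; simp [swapPerm_mul_self]
  · simp
  · rcases h2 with rfl | rfl
    · exact swapPerm_braid h3
    · have := congrArg (·⁻¹) (swapPerm_braid (i := j) h3)
      simpa only [← inv_pow, mul_inv_rev, inv_one, inv_eq_of_mul_eq_one_left (swapPerm_mul_self _)]
        using this
  · push Not at h2
    ext x
    simp only [pow_two, Equiv.Perm.coe_mul, Function.comp_apply, swapPerm_apply,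
      Equiv.Perm.coe_one, id]
    rw [swapFun_comm h2.1 h2.2, swapFun_swapFun, swapFun_swapFun]

/-- The action of the affine Weyl group on `ℤ`, in which `s_i` exchanges `x` and `x + 1` for every
`x` of residue `i`. -/
noncomputable def affPerm (e : ℕ) [Fact (1 < e)] : Weyl e →* Equiv.Perm ℤ :=
  (coxeterSystem e).lift ⟨swapPerm, isLiftable_swapPerm⟩

lemma affPerm_simple (i : ZMod e) (x : ℤ) :
    affPerm e ((coxeterSystem e).simple i) x = swapFun i x := by
  rw [affPerm, CoxeterSystem.lift_apply_simple]; rfl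

lemma affPerm_mul (u v : Weyl e) (x : ℤ) : affPerm e (u * v) x = affPerm e u (affPerm e v x) := by
  simp

lemma affPerm_add (w : Weyl e) (x : ℤ) : affPerm e w (x + e) = affPerm e w x + e := by
  induction w using (coxeterSystem e).simple_induction_left with
  | one => simp
  | mul_simple_left w i ih =>
    rw [affPerm_mul, affPerm_mul, ih, affPerm_simple, affPerm_simple, swapFun_add]

lemma affPerm_add_mul (w : Weyl e) (x k : ℤ) :
    affPerm e w (x + k * e) = affPerm e w x + k * e := by
  induction k with
  | zero => simp
  | succ k ih => rw [add_mul, one_mul, ← add_assoc, affPerm_add, ih]; ring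
  | pred k ih =>
    have := affPerm_add w (x + (-k - 1) * e)
    rw [show x + (-k - 1 : ℤ) * e + e = x + -k * e by ring, ih] at this
    linarith

lemma affPerm_cast_eq_iff (w : Weyl e) (x y : ℤ) :
    ((affPerm e w x : ℤ) : ZMod e) = (affPerm e w y : ℤ) ↔ (x : ZMod e) = y := by
  have key : ∀ (w : Weyl e) (x y : ℤ), (x : ZMod e) = y →
      ((affPerm e w x : ℤ) : ZMod e) = (affPerm e w y : ℤ) := by
    intro w x y h
    obtain ⟨k, rfl⟩ := exists_eq_add_mul h
    simp [affPerm_add_mul]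
  refine ⟨fun h => ?_, key w x y⟩
  have := key w⁻¹ _ _ h
  simpa using this

/-! ### Descents, lengths and the exchange condition -/

local notation "S" => coxeterSystem e

/-- Whether the values at `x` and `x + 1` are in order depends only on the residue of `x`. -/
lemma affPerm_lt_congr (w : Weyl e) {x y : ℤ} (h : (x : ZMod e) = y)
    (hy : affPerm e w y < affPerm e w (y + 1)) : affPerm e w x < affPerm e w (x + 1) := by
  obtain ⟨k, rfl⟩ := exists_eq_add_mul h
  rw [add_right_comm, affPerm_add_mul, affPerm_add_mul]
  linarith

/-- An ascent of length at `s_i` is an ascent of the permutation at the residue `i`.  The proof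
splits off a right descent `s_j` of `w` and works in the dihedral group generated by `s_i` and
`s_j`. -/
theorem affPerm_lt_of_length_lt (w : Weyl e) (i : ZMod e)
    (h : (S).length w < (S).length (w * (S).simple i)) (x : ℤ) (hx : (x : ZMod e) = i) :
    affPerm e w x < affPerm e w (x + 1) := by
  induction hn : (S).length w using Nat.strong_induction_on generalizing w i x with
  | _ n ih =>
  subst hn
  rcases eq_or_ne w 1 with rfl | hw1
  · simp
  obtain ⟨j, hj⟩ := (S).exists_rightDescent_of_ne_one hw1
  have hj' := ((S).isRightDescent_iff).1 hj
  have hi' : (S).length (w * (S).simple i) = (S).length w + 1 := by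
    rcases (S).length_mul_simple w i with h | h <;> omega
  have hij : i ≠ j := by
    rintro rfl
    unfold CoxeterSystem.IsRightDescent at hj
    omega
  obtain ⟨v, hv⟩ : ∃ v, v = w * (S).simple j := ⟨_, rfl⟩
  have hw : w = v * (S).simple j := by rw [hv, (S).simple_mul_simple_cancel_right]
  have hlv : (S).length v + 1 = (S).length w := by rw [hv]; exact hj'
  have vj : ∀ y : ℤ, (y : ZMod e) = j → affPerm e v y < affPerm e v (y + 1) := by
    intro y hy
    exact ih _ (by omega) v j (by rw [← hw]; omega) y hy rfl
  have hwx : ∀ y, affPerm e w y = affPerm e v (swapFun j y) := by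
    intro y; rw [hw, affPerm_mul, affPerm_simple]
  by_cases hadj : j = i + 1 ∨ i = j + 1
  · by_cases he2 : e = 2
    · subst he2
      have h11 : (1 : ZMod 2) + 1 = 0 := by decide
      have hj1 : j = i + 1 := by
        rcases hadj with h | h
        · exact h
        · rw [h, add_assoc, h11, add_zero]
      rw [hwx, hwx, swapFun_of_eq_add_one (by rw [hx, hj1, add_assoc, h11, add_zero]),
        swapFun_of_eq (by simp [hx, hj1])]
      have h1 := vj (x + 1) (by simp [hx, hj1])
      have h2 := affPerm_add_mul v (x - 1) 1
      rw [show x - 1 + 1 * ((2 : ℕ) : ℤ) = x + 1 by push_cast; ring] at h2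
      push_cast at h2
      omega
    · have hne : ∀ k : ZMod e, k + 1 + 1 ≠ k := by
        intro k h
        have h' : ((2 : ℕ) : ZMod e) = 0 := by
          have : k + (1 + 1) = k := by rw [← add_assoc]; exact h
          simpa [one_add_one_eq_two] using this
        rw [ZMod.natCast_eq_zero_iff] at h'
        have := Nat.le_of_dvd two_pos h'
        have := (Fact.out : 1 < e)
        omega
      rcases (S).length_mul_simple v i with hvi | hvi
      · have vi : ∀ y : ℤ, (y : ZMod e) = i → affPerm e v y < affPerm e v (y + 1) := by
          intro y hy
          exact ih _ (by omega) v i (by omega) y hy rfl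
        rw [hwx, hwx]
        rcases hadj with rfl | rfl
        · rw [swapFun_of_ne (by simp [hx]) (by rw [hx]; exact (hne i).symm),
            swapFun_of_eq (by simp [hx])]
          exact (vi x hx).trans (vj _ (by simp [hx]))
        · rw [swapFun_of_eq_add_one hx, swapFun_of_ne (by simpa [hx] using hne j) (by simp [hx])]
          have := vj (x - 1) (by simp [hx])
          rw [sub_add_cancel] at this
          exact this.trans (vi x hx)
      · -- Here `w = v' s_i s_j`, and `s_i s_j` maps the root of `s_i` to that of `s_j`.
        obtain ⟨v', hv'⟩ : ∃ v', v' = v * (S).simple i := ⟨_, rfl⟩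
        have hvv : v = v' * (S).simple i := by
          rw [hv', (S).simple_mul_simple_cancel_right]
        have hbraid : v' * (S).simple j = w * (S).simple i * (S).simple j * (S).simple i := by
          have hM : (coxeterMatrix e).M j i = 3 := by
            simp only [coxeterMatrix, Matrix.of_apply, if_neg hij.symm, if_neg he2]
            rw [if_pos hadj.symm]
          have h3 := (S).simple_mul_simple_pow j i
          rw [show (coxeterMatrix e) j i = 3 from hM] at h3
          have h4 : (S).simple j * (S).simple i * (S).simple j =
              (S).simple i * (S).simple j * (S).simple i := by
            rw [← mul_inv_eq_one]
            simpa only [pow_succ, pow_zero, one_mul, mul_assoc, mul_inv_rev, (S).inv_simple]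
              using h3
          rw [hv', hv, mul_assoc, mul_assoc, ← mul_assoc ((S).simple j), h4]
          simp [mul_assoc]
        have hl : (S).length v' < (S).length (v' * (S).simple j) := by
          rw [hbraid, hv']
          have h1 := (S).length_mul_simple (w * (S).simple i) j
          have h2 := (S).length_mul_simple (w * (S).simple i * (S).simple j) i
          omega
        have v'j : ∀ y : ℤ, (y : ZMod e) = j → affPerm e v' y < affPerm e v' (y + 1) := by
          intro y hy
          exact ih _ (by rw [hv']; omega) v' j hl y hy rfl
        have hvx : ∀ y, affPerm e v y = affPerm e v' (swapFun i y) := by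
          intro y; rw [hvv, affPerm_mul, affPerm_simple]
        rw [hwx, hwx, hvx, hvx]
        rcases hadj with rfl | rfl
        · rw [swapFun_of_ne (i := i + 1) (by simp [hx]) (by rw [hx]; exact (hne i).symm),
            swapFun_of_eq (i := i + 1) (by simp [hx]), swapFun_of_eq hx,
            swapFun_of_ne (by simpa [hx] using hne i) (by simp [hx])]
          exact v'j _ (by simp [hx])
        · rw [swapFun_of_eq_add_one (i := j) hx,
            swapFun_of_ne (i := j) (by simpa [hx] using hne j) (by simp [hx]),
            swapFun_of_ne (by simp [hx]) (by simpa [hx] using (hne j).symm),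
            swapFun_of_eq_add_one (by simp [hx])]
          have := v'j (x - 1) (by simp [hx])
          simpa using this
  · push Not at hadj
    have hcomm : (S).simple j * (S).simple i = (S).simple i * (S).simple j := by
      have hM : (coxeterMatrix e).M j i = 2 := by
        simp only [coxeterMatrix, Matrix.of_apply, if_neg hij.symm]
        rw [if_neg (by tauto)]
      have h2 := (S).simple_mul_simple_pow j i
      rw [show (coxeterMatrix e) j i = 2 from hM] at h2
      rw [← mul_inv_eq_one]
      simpa only [pow_succ, pow_zero, one_mul, mul_assoc, mul_inv_rev, (S).inv_simple] using h2
    have hl : (S).length v < (S).length (v * (S).simple i) := by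
      rw [hv, mul_assoc, hcomm, ← mul_assoc]
      have h1 := (S).length_mul_simple (w * (S).simple i) j
      have h2 : (S).length (w * (S).simple j) + 1 = (S).length w := hj'
      omega
    have := ih _ (by omega) v i hl x hx rfl
    rw [hwx, hwx, swapFun_of_ne (by rw [hx]; exact hij) (by rw [hx]; exact hadj.2),
      swapFun_of_ne (by simpa [hx] using hadj.1.symm) (by simpa [hx] using hij)]
    exact this

lemma affPerm_lt_iff_length_lt (w : Weyl e) (i : ZMod e) (x : ℤ) (hx : (x : ZMod e) = i) :
    affPerm e w x < affPerm e w (x + 1) ↔ (S).length w < (S).length (w * (S).simple i) := by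
  refine ⟨fun h => ?_, fun h => affPerm_lt_of_length_lt w i h x hx⟩
  by_contra hlt
  have hne := (S).length_mul_simple_ne w i
  have := affPerm_lt_of_length_lt (w * (S).simple i) i
    (by rw [(S).simple_mul_simple_cancel_right]; omega) x hx
  simp only [affPerm_mul, affPerm_simple, swapFun_of_eq hx,
    swapFun_of_eq_add_one (x := x + 1) (i := i) (by simp [hx]), add_sub_cancel_right] at this
  omega

/-- A permutation without descents comes from the identity only. -/
lemma eq_one_of_forall_lt (w : Weyl e) (h : ∀ x : ℤ, affPerm e w x < affPerm e w (x + 1)) :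
    w = 1 := by
  by_contra hw
  obtain ⟨j, hj⟩ := (S).exists_rightDescent_of_ne_one hw
  obtain ⟨x, rfl⟩ := ZMod.intCast_surjective j
  have := (affPerm_lt_iff_length_lt w _ x rfl).1 (h x)
  unfold CoxeterSystem.IsRightDescent at hj
  omega

lemma affPerm_injective : Function.Injective (affPerm e) := by
  rw [injective_iff_map_eq_one]
  intro w hw
  exact eq_one_of_forall_lt w (by simp [hw])

/-- A reflection acts as an involution moving points only by exchanging two residue classes;
so it is simple as soon as it maps some `z` to `z + 1`. -/
lemma isReflection_eq_simple {t : Weyl e} (ht : (S).IsReflection t) {z : ℤ}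
    (hz : affPerm e t z = z + 1) : t = (S).simple (z : ZMod e) := by
  have hinv : affPerm e t (z + 1) = z := by
    rw [← hz, ← affPerm_mul, ht.mul_self]; simp
  apply affPerm_injective
  ext x
  rw [affPerm_simple]
  by_cases h1 : (x : ZMod e) = z
  · rw [swapFun_of_eq h1]
    obtain ⟨k, rfl⟩ := exists_eq_add_mul h1
    rw [affPerm_add_mul, hz]; ring
  by_cases h2 : (x : ZMod e) = z + 1
  · rw [swapFun_of_eq_add_one h2]
    obtain ⟨k, rfl⟩ := exists_eq_add_mul (y := z + 1) (by simpa using h2)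
    rw [affPerm_add_mul, hinv]; ring
  rw [swapFun_of_ne h1 h2]
  obtain ⟨g, j, rfl⟩ := ht
  simp only [affPerm_mul, affPerm_simple] at hz ⊢
  have hg : ∀ y, affPerm e g (affPerm e g⁻¹ y) = y := fun y => by
    rw [← affPerm_mul]; simp
  have hz' : swapFun j (affPerm e g⁻¹ z) = affPerm e g⁻¹ (z + 1) := by
    rw [← hz, ← affPerm_mul]; simp
  have h1' := mt (affPerm_cast_eq_iff g⁻¹ x z).1 h1
  have h2' := mt (affPerm_cast_eq_iff g⁻¹ x (z + 1)).1 (by simpa using h2)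
  rw [← hz'] at h2'
  have hfix : swapFun j (affPerm e g⁻¹ x) = affPerm e g⁻¹ x := by
    by_cases h3 : ((affPerm e g⁻¹ z : ℤ) : ZMod e) = j
    · rw [swapFun_of_eq h3] at h2'
      push_cast at h2'
      rw [h3] at h1' h2'
      exact swapFun_of_ne h1' h2'
    by_cases h4 : ((affPerm e g⁻¹ z : ℤ) : ZMod e) = j + 1
    · rw [swapFun_of_eq_add_one h4] at h2'
      push_cast at h2'
      rw [h4] at h1' h2'
      exact swapFun_of_ne (by simpa using h2') h1'
    rw [swapFun_of_ne h3 h4] at hz'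
    have := (affPerm e g⁻¹).injective hz'
    omega
  rw [hfix, hg]

/-- Strong exchange condition: if a reflection exchanges `x < t x`, and a word inverts
these two points, then a letter of the word can be deleted to give its product with `t`. -/
lemma exists_word_of_inversion {t : Weyl e} (ht : (S).IsReflection t) {x : ℤ}
    (hx : x < affPerm e t x) (ω : List (ZMod e))
    (h : affPerm e ((S).wordProd ω) (affPerm e t x) < affPerm e ((S).wordProd ω) x) :
    ∃ ω' : List (ZMod e), ω'.length + 1 = ω.length ∧ (S).wordProd ω' = (S).wordProd ω * t := by
  induction ω with
  | nil => simp at h; omega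
  | cons i ω ih =>
    rcases lt_trichotomy (affPerm e ((S).wordProd ω) (affPerm e t x))
      (affPerm e ((S).wordProd ω) x) with h1 | h1 | h1
    · obtain ⟨ω', hl, hω⟩ := ih h1
      exact ⟨i :: ω', by simp [hl], by rw [CoxeterSystem.wordProd_cons, hω,
        CoxeterSystem.wordProd_cons, mul_assoc]⟩
    · have := (affPerm e _).injective h1
      omega
    · -- The letter `i` inverts the pair, so the conjugate of `t` is the simple reflection `s_i`.
      refine ⟨ω, rfl, ?_⟩
      rw [CoxeterSystem.wordProd_cons] at h ⊢
      simp only [affPerm_mul, affPerm_simple] at h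
      set u := (S).wordProd ω
      set a := affPerm e u x with ha
      set b := affPerm e u (affPerm e t x) with hb
      have hab : b = a + 1 ∧ (a : ZMod e) = i := by
        exact swapFun_lt_swapFun h1 h
      have hr := ht.conj u
      have hz : affPerm e (u * t * u⁻¹) a = a + 1 := by
        rw [← hab.1, hb]
        simp [ha]
      have := isReflection_eq_simple hr hz
      rw [hab.2] at this
      rw [← this]
      simp only [mul_assoc, inv_mul_cancel_left, ht.mul_self, mul_one]

/-- For a reflection `t` and `x < t x`, multiplication by `t` on the right increases the length
exactly if the values at `x` and `t x` are in order. -/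
lemma affPerm_lt_iff_length_lt_reflection {t : Weyl e} (ht : (S).IsReflection t) (u : Weyl e)
    {x : ℤ} (hx : x < affPerm e t x) :
    affPerm e u x < affPerm e u (affPerm e t x) ↔ (S).length u < (S).length (u * t) := by
  have key : ∀ v : Weyl e, affPerm e v (affPerm e t x) < affPerm e v x →
      (S).length (v * t) < (S).length v := by
    intro v hv
    obtain ⟨ω, hω, rfl⟩ := (S).exists_isReduced v
    obtain ⟨ω', hl, h'⟩ := exists_word_of_inversion ht hx ω hv
    rw [hω.eq, ← h']
    have := (S).length_wordProd_le ω'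
    omega
  have hinv : affPerm e t (affPerm e t x) = x := by
    rw [← affPerm_mul, ht.mul_self]; simp
  constructor
  · intro h
    have := key (u * t) (by simpa only [affPerm_mul, hinv] using h)
    rwa [mul_assoc, ht.mul_self, mul_one] at this
  · intro h
    rcases lt_trichotomy (affPerm e u x) (affPerm e u (affPerm e t x)) with h1 | h1 | h1
    · exact h1
    · have := (affPerm e _).injective h1
      omega
    · have := key u h1
      omega

end AffineCrystal

namespace AffineCrystal

variable {e : ℕ}

local notation "S" => coxeterSystem e

/-! ### The Bruhat order -/

lemma bruhatLE_simple_mul {v : Weyl e} {i : ZMod e}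
    (h : (S).length v < (S).length ((S).simple i * v)) : BruhatLE e v ((S).simple i * v) := by
  refine Relation.ReflTransGen.single ⟨v⁻¹ * (S).simple i * v, ?_, ?_, h⟩
  · have := ((S).isReflection_simple i).conj v⁻¹
    rwa [inv_inv] at this
  · simp only [mul_assoc, mul_inv_cancel_left]

lemma bruhatLE_of_simple_mul_lt {v : Weyl e} {i : ZMod e}
    (h : (S).length ((S).simple i * v) < (S).length v) : BruhatLE e ((S).simple i * v) v := by
  have := bruhatLE_simple_mul (v := (S).simple i * v) (i := i)
    (by rwa [(S).simple_mul_simple_cancel_left])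
  rwa [(S).simple_mul_simple_cancel_left] at this

/-! ### Comparing sets of integers by counting -/

/-- The number of elements of `J` that are at least `y` (meaningful for `J` bounded above). -/
noncomputable def countAbove (J : Set ℤ) (y : ℤ) : ℕ := {x ∈ J | y ≤ x}.ncard

lemma finite_sep_le {J : Set ℤ} (hJ : BddAbove J) (y : ℤ) : {x ∈ J | y ≤ x}.Finite := by
  obtain ⟨B, hB⟩ := hJ
  exact (Set.finite_Icc y B).subset fun x hx => ⟨hx.2, hB hx.1⟩

lemma countAbove_of_mem {J : Set ℤ} (hJ : BddAbove J) {y : ℤ} (hy : y ∈ J) :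
    countAbove J y = countAbove J (y + 1) + 1 := by
  have : {x ∈ J | y ≤ x} = insert y {x ∈ J | y + 1 ≤ x} := by
    ext x
    simp only [Set.mem_ofPred_eq, Set.mem_insert_iff]
    constructor
    · rintro ⟨h1, h2⟩
      rcases h2.eq_or_lt with h | h
      · exact Or.inl h.symm
      · exact Or.inr ⟨h1, h⟩
    · rintro (rfl | ⟨h1, h2⟩)
      · exact ⟨hy, le_rfl⟩
      · exact ⟨h1, by omega⟩
  rw [countAbove, this, Set.ncard_insert_of_notMem (by simp) (finite_sep_le hJ _)]
  rfl

lemma countAbove_of_notMem {J : Set ℤ} {y : ℤ} (hy : y ∉ J) :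
    countAbove J y = countAbove J (y + 1) := by
  unfold countAbove
  congr 1
  ext x
  simp only [Set.mem_ofPred_eq, and_congr_right_iff]
  intro hx
  have : x ≠ y := fun h => hy (h ▸ hx)
  omega

lemma countAbove_bounds {J : Set ℤ} (hJ : BddAbove J) (y : ℤ) :
    countAbove J (y + 1) ≤ countAbove J y ∧ countAbove J y ≤ countAbove J (y + 1) + 1 := by
  by_cases hy : y ∈ J
  · rw [countAbove_of_mem hJ hy]; omega
  · rw [countAbove_of_notMem hy]; omega

/-- `L` dominates `K`: above every bound there are at least as many elements of `L` as of `K`.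
For sets of beta numbers of the same charge this is containment of Young diagrams. -/
def Dominated (K L : Set ℤ) : Prop := ∀ y, countAbove K y ≤ countAbove L y

/-- If `K` has no removable nodes of residue `i`, the bounds for the residue `i + 1` follow from
those for the two neighbouring residues. -/
lemma dominated_of_forall_ne {K L : Set ℤ} (hK : BddAbove K) (hL : BddAbove L) {i : ZMod e}
    (hmin : ∀ z : ℤ, (z : ZMod e) = i → z + 1 ∈ K → z ∈ K)
    (h : ∀ y : ℤ, (y : ZMod e) ≠ i + 1 → countAbove K y ≤ countAbove L y) [Fact (1 < e)] :
    Dominated K L := by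
  intro y
  by_cases hy : (y : ZMod e) = i + 1
  · by_cases hyK : y ∈ K
    · have h1 := h (y - 1) (by simp [hy])
      have h2 := countAbove_of_mem hK (y := y - 1)
        (hmin (y - 1) (by simp [hy]) (by simpa using hyK))
      have h3 := (countAbove_bounds hL (y - 1)).2
      rw [sub_add_cancel] at h2 h3
      omega
    · have h1 := h (y + 1) (by simp [hy])
      have h2 := countAbove_of_notMem hyK
      have h3 := (countAbove_bounds hL y).1
      omega
  · exact h y hy

variable [Fact (1 < e)]

lemma countAbove_swapPerm_image (J : Set ℤ) {i : ZMod e} {y : ℤ} (hy : (y : ZMod e) ≠ i + 1) :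
    countAbove (swapPerm i '' J) y = countAbove J y := by
  have : {x ∈ swapPerm i '' J | y ≤ x} = swapPerm i '' {x ∈ J | y ≤ x} := by
    have key : ∀ x : ℤ, y ≤ swapPerm i x ↔ y ≤ x := by
      intro x
      simp only [swapPerm_apply, swapFun]
      split_ifs with h1 h2
      · have : y ≠ x + 1 := by rintro rfl; exact hy (by simp [h1])
        omega
      · have : y ≠ x := by rintro rfl; exact hy h2
        omega
      · rfl
    ext x
    simp only [Set.mem_ofPred_eq, Set.mem_image]
    constructor
    · rintro ⟨⟨z, hz, rfl⟩, h⟩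
      exact ⟨z, ⟨hz, (key z).1 h⟩, rfl⟩
    · rintro ⟨z, ⟨hz, h⟩, rfl⟩
      exact ⟨⟨z, hz, rfl⟩, (key z).2 h⟩
  rw [countAbove, this, Set.ncard_image_of_injective _ (swapPerm i).injective]
  rfl

/-! ### The orbit of the half line -/

/-- The image of the half line `{x | x ≤ m}`; it is the set of beta numbers of charge `m` of the
core `w ∅_m`. -/
def orbitSet (m : ℤ) (w : Weyl e) : Set ℤ := affPerm e w '' Set.Iic m

lemma mem_orbitSet {m : ℤ} {w : Weyl e} {x : ℤ} :
    x ∈ orbitSet m w ↔ affPerm e w⁻¹ x ≤ m := by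
  constructor
  · rintro ⟨y, hy, rfl⟩
    rw [← affPerm_mul]
    simpa using hy
  · intro h
    refine ⟨_, h, ?_⟩
    rw [← affPerm_mul]
    simp

lemma apply_mem_orbitSet {m : ℤ} {w : Weyl e} {x : ℤ} :
    affPerm e w x ∈ orbitSet m w ↔ x ≤ m := by
  rw [mem_orbitSet, ← affPerm_mul]
  simp

@[simp] lemma orbitSet_one (m : ℤ) : orbitSet m (1 : Weyl e) = Set.Iic m := by
  simp [orbitSet]

lemma orbitSet_mul (m : ℤ) (u v : Weyl e) :
    orbitSet m (u * v) = affPerm e u '' orbitSet m v := by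
  simp only [orbitSet, map_mul, Equiv.Perm.coe_mul, Set.image_comp]

lemma orbitSet_simple_mul (m : ℤ) (i : ZMod e) (w : Weyl e) :
    orbitSet m ((S).simple i * w) = swapPerm i '' orbitSet m w := by
  rw [orbitSet_mul]
  exact Set.image_congr fun x _ => affPerm_simple i x

lemma countAbove_orbitSet (m : ℤ) (w : Weyl e) (y : ℤ) :
    countAbove (orbitSet m w) y = {x | x ≤ m ∧ y ≤ affPerm e w x}.ncard := by
  rw [← Set.ncard_image_of_injective _ (affPerm e w).injective]
  unfold countAbove orbitSet
  congr 1
  ext x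
  constructor
  · rintro ⟨⟨z, hz, rfl⟩, h⟩
    exact ⟨z, ⟨hz, h⟩, rfl⟩
  · rintro ⟨z, ⟨hz, h⟩, rfl⟩
    exact ⟨⟨z, hz, rfl⟩, h⟩

lemma sub_mem_orbitSet {m : ℤ} {w : Weyl e} {x : ℤ} (hx : x ∈ orbitSet m w) :
    x - e ∈ orbitSet m w := by
  rw [mem_orbitSet] at hx ⊢
  have := affPerm_add w⁻¹ (x - e)
  rw [sub_add_cancel] at this
  omega

lemma bddAbove_orbitSet (m : ℤ) (w : Weyl e) : BddAbove (orbitSet m w) := by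
  obtain ⟨C, hC⟩ : ∃ C, ∀ x, affPerm e w x ≤ x + C := by
    induction w using (S).simple_induction_left with
    | one => exact ⟨0, by simp⟩
    | mul_simple_left w i ih =>
      obtain ⟨C, hC⟩ := ih
      refine ⟨C + 1, fun x => ?_⟩
      have : ∀ z, swapFun i z ≤ z + 1 := by
        intro z; unfold swapFun; split_ifs <;> omega
      rw [affPerm_mul, affPerm_simple]
      linarith [this (affPerm e w x), hC x]
  refine ⟨m + C, ?_⟩
  rintro _ ⟨x, hx, rfl⟩
  have := hC x
  have : x ≤ m := hx
  linarith

lemma lt_of_mem_of_notMem_orbitSet {m : ℤ} {w : Weyl e} {x y : ℤ} (h : (x : ZMod e) = y)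
    (hx : x ∈ orbitSet m w) (hy : y ∉ orbitSet m w) : x < y := by
  obtain ⟨k, rfl⟩ := exists_eq_add_mul h
  rw [mem_orbitSet] at hx hy
  rw [affPerm_add_mul] at hx
  have : (0 : ℤ) < e := by have := (Fact.out : 1 < e); omega
  by_contra hlt
  have : 0 ≤ k * (e : ℤ) := by linarith
  linarith

/-! ### Bruhat order, domination and lifting -/

lemma BruhatLE.dominated {u v : Weyl e} (h : BruhatLE e u v) (m : ℤ) :
    Dominated (orbitSet m u) (orbitSet m v) := by
  induction h with
  | refl => exact fun y => le_rfl
  | @tail u v _ hstep ih =>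
    intro y
    refine (ih y).trans ?_
    obtain ⟨t, ht, rfl, hl⟩ := hstep
    have htt : ∀ x, affPerm e t (affPerm e t x) = x := fun x => by
      rw [← affPerm_mul, ht.mul_self]; simp
    have hlt : ∀ x, x < affPerm e t x → affPerm e u x < affPerm e u (affPerm e t x) :=
      fun x hx => (affPerm_lt_iff_length_lt_reflection ht u hx).2 hl
    rw [countAbove_orbitSet, countAbove_orbitSet]
    -- A position `x` is kept if `u t x` lies above `y`; otherwise `t x < x`, and `x` is sent
    -- to `t x`.
    have hfin : {x | x ≤ m ∧ y ≤ affPerm e (u * t) x}.Finite := by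
      refine Set.Finite.of_finite_image (f := affPerm e (u * t))
        ((finite_sep_le (bddAbove_orbitSet m (u * t)) y).subset ?_)
        (affPerm e (u * t)).injective.injOn
      rintro _ ⟨x, ⟨hx, hxy⟩, rfl⟩
      exact ⟨apply_mem_orbitSet.2 hx, hxy⟩
    refine Set.ncard_le_ncard_of_injOn
      (fun x => if y ≤ affPerm e (u * t) x then x else affPerm e t x) ?_ ?_ hfin
    · rintro x ⟨hx, hxy⟩
      split_ifs with h1
      · exact ⟨hx, h1⟩
      · rw [affPerm_mul] at h1
        refine ⟨?_, by rwa [affPerm_mul, htt]⟩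
        by_contra hm
        have := hlt x (by omega)
        omega
    · have aux : ∀ x z, y ≤ affPerm e u z → ¬ y ≤ affPerm e (u * t) x → z ≠ affPerm e t x := by
        rintro x _ hz hx rfl
        rw [affPerm_mul] at hx
        exact hx hz
      rintro x ⟨hx, hxy⟩ z ⟨hz, hzy⟩ hxz
      dsimp only at hxz
      split_ifs at hxz with h1 h2 h2
      · exact hxz
      · exact absurd hxz (aux z x hxy h2)
      · exact absurd hxz.symm (aux x z hzy h1)
      · exact (affPerm e t).injective hxz

/-- The lifting property of the Bruhat order. -/
lemma BruhatLE.simple_mul {x y : Weyl e} (h : BruhatLE e x y) (i : ZMod e) :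
    BruhatLE e ((S).simple i * x) y ∨ BruhatLE e ((S).simple i * x) ((S).simple i * y) := by
  induction h using Relation.ReflTransGen.head_induction_on with
  | refl => exact Or.inr Relation.ReflTransGen.refl
  | @head x x₁ hstep hle ih =>
    obtain ⟨t, ht, rfl, hl⟩ := hstep
    by_cases hl' : (S).length ((S).simple i * x) < (S).length ((S).simple i * (x * t))
    · have h1 : BruhatLE e ((S).simple i * x) ((S).simple i * (x * t)) :=
        Relation.ReflTransGen.single ⟨t, ht, by rw [mul_assoc], hl'⟩
      exact ih.imp h1.trans h1.trans
    · -- The pair of values exchanged by `t` must then be inverted by `s_i`, so `s_i x = x t`.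
      left
      obtain ⟨z, hz⟩ : ∃ z, z < affPerm e t z := by
        by_contra hno
        push Not at hno
        have h1 : ∀ z, affPerm e t z = z := by
          intro z
          have h2 := hno (affPerm e t z)
          rw [← affPerm_mul, ht.mul_self] at h2
          have h3 := hno z
          simp only [map_one, Equiv.Perm.coe_one, id] at h2
          omega
        have : t = 1 := affPerm_injective (by ext z; simp [h1])
        simp [this] at hl
      have h1 := (affPerm_lt_iff_length_lt_reflection ht x hz).2 hl
      have h2 := mt (affPerm_lt_iff_length_lt_reflection ht ((S).simple i * x) hz).1
        (by rwa [mul_assoc])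
      simp only [affPerm_mul, affPerm_simple] at h2
      have h3 : swapFun i (affPerm e x (affPerm e t z)) < swapFun i (affPerm e x z) := by
        refine lt_of_le_of_ne (not_lt.1 h2) fun h => ?_
        have := (swapPerm i).injective h
        omega
      obtain ⟨h4, h5⟩ := swapFun_lt_swapFun h1 h3
      have h6 := isReflection_eq_simple (ht.conj x) (z := affPerm e x z) (by
        rw [← h4]; simp)
      rw [h5] at h6
      rw [← h6, inv_mul_cancel_right]
      exact hle

end AffineCrystal

namespace AffineCrystal

variable {e : ℕ}

/-! ### Beta numbers of partitions -/

/-- The `k`-th beta number of charge `m`. -/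
def betaNum (m : ℤ) (lam : YoungDiagram) (k : ℕ) : ℤ := (lam.rowLen k : ℤ) + m - (k : ℤ)

lemma betaNum_mem (m : ℤ) (lam : YoungDiagram) (k : ℕ) : betaNum m lam k ∈ betaSet m lam :=
  ⟨k, rfl⟩

lemma betaNum_strictAnti (m : ℤ) (lam : YoungDiagram) : StrictAnti (betaNum m lam) := by
  intro j k hjk
  have := lam.rowLen_anti j k hjk.le
  simp only [betaNum]
  omega

lemma bddAbove_betaSet (m : ℤ) (lam : YoungDiagram) : BddAbove (betaSet m lam) := by
  refine ⟨betaNum m lam 0, ?_⟩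
  rintro _ ⟨k, rfl⟩
  exact (betaNum_strictAnti m lam).antitone (Nat.zero_le k)

lemma le_iff_rowLen_le {lam mu : YoungDiagram} :
    lam ≤ mu ↔ ∀ k, lam.rowLen k ≤ mu.rowLen k := by
  constructor
  · intro h k
    by_contra hk
    push Not at hk
    have := YoungDiagram.mem_iff_lt_rowLen.1 (h (YoungDiagram.mem_iff_lt_rowLen.2 hk))
    omega
  · rintro h ⟨k, c⟩ hc
    exact YoungDiagram.mem_iff_lt_rowLen.2 ((YoungDiagram.mem_iff_lt_rowLen.1 hc).trans_le (h k))

lemma countAbove_betaSet (m : ℤ) (lam : YoungDiagram) (y : ℤ) :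
    countAbove (betaSet m lam) y = {k | y ≤ betaNum m lam k}.ncard := by
  rw [← Set.ncard_image_of_injective _ (betaNum_strictAnti m lam).injective]
  unfold countAbove
  congr 1
  ext x
  constructor
  · rintro ⟨⟨k, rfl⟩, h⟩
    exact ⟨k, h, rfl⟩
  · rintro ⟨k, h, rfl⟩
    exact ⟨⟨k, rfl⟩, h⟩

lemma finite_le_betaNum (m : ℤ) (lam : YoungDiagram) (y : ℤ) :
    {k | y ≤ betaNum m lam k}.Finite := by
  refine Set.Finite.of_finite_image (f := betaNum m lam)
    ((finite_sep_le (bddAbove_betaSet m lam) y).subset ?_)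
    (betaNum_strictAnti m lam).injective.injOn
  rintro _ ⟨k, hk, rfl⟩
  exact ⟨betaNum_mem m lam k, hk⟩

lemma le_iff_dominated (m : ℤ) {lam mu : YoungDiagram} :
    lam ≤ mu ↔ Dominated (betaSet m lam) (betaSet m mu) := by
  rw [le_iff_rowLen_le]
  constructor
  · intro h y
    rw [countAbove_betaSet, countAbove_betaSet]
    refine Set.ncard_le_ncard (fun k hk => ?_) (finite_le_betaNum m mu y)
    have := h k
    have hk' : y ≤ betaNum m lam k := hk
    show y ≤ betaNum m mu k
    simp only [betaNum] at hk' ⊢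
    omega
  · intro h k
    by_contra hk
    push Not at hk
    have h1 := h (betaNum m lam k)
    rw [countAbove_betaSet, countAbove_betaSet] at h1
    have h2 : (Set.Iic k).ncard ≤ {j | betaNum m lam k ≤ betaNum m lam j}.ncard :=
      Set.ncard_le_ncard (fun j hj => (betaNum_strictAnti m lam).antitone hj)
        (finite_le_betaNum m lam _)
    have h3 : {j | betaNum m lam k ≤ betaNum m mu j}.ncard ≤ (Set.Iio k).ncard := by
      refine Set.ncard_le_ncard (fun j hj => ?_) (Set.finite_Iio k)
      by_contra hjk
      have hj' : betaNum m lam k ≤ betaNum m mu j := hj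
      have h4 := (betaNum_strictAnti m mu).antitone (not_lt.1 hjk)
      simp only [betaNum] at hj' h4
      omega
    have h5 : (Set.Iic k).ncard = k + 1 := by
      rw [← Finset.coe_Iic, Set.ncard_coe_finset, Nat.card_Iic]
    have h6 : (Set.Iio k).ncard = k := by
      rw [← Finset.coe_Iio, Set.ncard_coe_finset, Nat.card_Iio]
    omega

lemma betaSet_injective (m : ℤ) : Function.Injective (betaSet m) := by
  intro lam mu h
  refine le_antisymm ?_ ?_ <;> rw [le_iff_dominated m, h] <;> exact fun y => le_rfl

lemma rowLen_bot (k : ℕ) : (⊥ : YoungDiagram).rowLen k = 0 := by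
  by_contra h
  have : (k, 0) ∈ (⊥ : YoungDiagram) := YoungDiagram.mem_iff_lt_rowLen.2 (Nat.pos_of_ne_zero h)
  exact YoungDiagram.notMem_bot _ this

lemma betaSet_bot (m : ℤ) : betaSet m ⊥ = Set.Iic m := by
  ext x
  simp only [betaSet, rowLen_bot, Set.mem_range, Set.mem_Iic]
  constructor
  · rintro ⟨k, rfl⟩; push_cast; omega
  · intro h
    exact ⟨(m - x).toNat, by push_cast; omega⟩

lemma rowLen_eq_zero_iff {lam : YoungDiagram} {k : ℕ} : lam.rowLen k = 0 ↔ lam.colLen 0 ≤ k := by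
  have h1 : 0 < lam.rowLen k ↔ k < lam.colLen 0 := by
    rw [← YoungDiagram.mem_iff_lt_rowLen, YoungDiagram.mem_iff_lt_colLen]
  omega

lemma isAddable_iff_rowLen {lam : YoungDiagram} {k : ℕ} :
    IsAddable lam (k, lam.rowLen k) ↔ ∀ j < k, lam.rowLen k < lam.rowLen j := by
  constructor
  · rintro ⟨-, h⟩ j hj
    have h1 : (j, lam.rowLen k) ∈ (insert (k, lam.rowLen k) lam.cells : Finset (ℕ × ℕ)) :=
      h (show (j, lam.rowLen k) ≤ (k, lam.rowLen k) from ⟨hj.le, le_rfl⟩)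
        (Finset.mem_coe.2 (Finset.mem_insert_self _ _))
    rcases Finset.mem_insert.1 h1 with h2 | h2
    · simp only [Prod.mk.injEq] at h2
      omega
    · exact YoungDiagram.mem_iff_lt_rowLen.1 h2
  · intro h
    refine ⟨fun h1 => lt_irrefl _ (YoungDiagram.mem_iff_lt_rowLen.1 h1), ?_⟩
    rintro a ⟨j, c⟩ hba ha
    rcases Finset.mem_insert.1 (Finset.mem_coe.1 ha) with rfl | ha
    · obtain ⟨hj, hc⟩ := hba
      simp only at hj hc
      rcases hj.eq_or_lt with rfl | hj
      · rcases hc.eq_or_lt with rfl | hc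
        · exact Finset.mem_coe.2 (Finset.mem_insert_self _ _)
        · exact Finset.mem_coe.2 (Finset.mem_insert_of_mem (YoungDiagram.mem_iff_lt_rowLen.2 hc))
      · exact Finset.mem_coe.2 (Finset.mem_insert_of_mem
          (YoungDiagram.mem_iff_lt_rowLen.2 (hc.trans_lt (h j hj))))
    · exact Finset.mem_coe.2 (Finset.mem_insert_of_mem (lam.isLowerSet hba ha))

lemma isAddable_iff (m : ℤ) {lam : YoungDiagram} {k : ℕ} :
    IsAddable lam (k, lam.rowLen k) ↔ betaNum m lam k + 1 ∉ betaSet m lam := by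
  rw [isAddable_iff_rowLen]
  constructor
  · rintro h ⟨j, hj⟩
    have hj' : betaNum m lam j = betaNum m lam k + 1 := hj
    have hjk : j < k := (betaNum_strictAnti m lam).lt_iff_gt.1 (by omega)
    have := h j hjk
    simp only [betaNum] at hj'
    omega
  · intro h j hj
    by_contra hlt
    apply h
    have h1 := lam.rowLen_anti j (k - 1) (by omega)
    have h2 := lam.rowLen_anti (k - 1) k (by omega)
    refine ⟨k - 1, ?_⟩
    simp only [betaNum]
    push_cast [show 1 ≤ k by omega]
    omega

lemma isRemovable_iff_rowLen {lam : YoungDiagram} {k : ℕ} :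
    IsRemovable lam (k, lam.rowLen k - 1) ↔ lam.rowLen (k + 1) < lam.rowLen k := by
  constructor
  · rintro ⟨h0, h⟩
    have h0' := YoungDiagram.mem_iff_lt_rowLen.1 h0
    by_contra hlt
    have h1 : (k + 1, lam.rowLen k - 1) ∈ lam.cells :=
      YoungDiagram.mem_iff_lt_rowLen.2 (by omega)
    have h2 := h (show (k, lam.rowLen k - 1) ≤ (k + 1, lam.rowLen k - 1) from
      ⟨Nat.le_succ k, le_rfl⟩) (Finset.mem_coe.2 (Finset.mem_erase.2 ⟨by simp, h1⟩))
    simp at h2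
  · intro h
    refine ⟨YoungDiagram.mem_iff_lt_rowLen.2 (by omega), ?_⟩
    rintro ⟨a, c⟩ b hba ha
    obtain ⟨hne, ha⟩ := Finset.mem_erase.1 (Finset.mem_coe.1 ha)
    refine Finset.mem_coe.2 (Finset.mem_erase.2 ⟨?_, lam.isLowerSet hba ha⟩)
    rintro rfl
    obtain ⟨hk, hc⟩ := hba
    simp only at hk hc
    have ha' := YoungDiagram.mem_iff_lt_rowLen.1 ha
    rcases hk.eq_or_lt with rfl | hk
    · apply hne
      rw [Prod.mk.injEq]
      exact ⟨rfl, by omega⟩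
    · have := lam.rowLen_anti (k + 1) a hk
      omega

lemma isRemovable_iff (m : ℤ) {lam : YoungDiagram} {k : ℕ} :
    IsRemovable lam (k, lam.rowLen k - 1) ↔ betaNum m lam k - 1 ∉ betaSet m lam := by
  rw [isRemovable_iff_rowLen]
  constructor
  · rintro h ⟨j, hj⟩
    have hj' : betaNum m lam j = betaNum m lam k - 1 := hj
    have hjk : k < j := (betaNum_strictAnti m lam).lt_iff_gt.1 (by omega)
    have := lam.rowLen_anti (k + 1) j hjk
    simp only [betaNum] at hj'
    omega
  · intro h
    by_contra hlt
    apply h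
    have h2 := lam.rowLen_anti k (k + 1) (by omega)
    refine ⟨k + 1, ?_⟩
    simp only [betaNum]
    push_cast
    omega

lemma residue_add (m : ℤ) (lam : YoungDiagram) (k : ℕ) :
    residue e m (k, lam.rowLen k) = (betaNum m lam k : ℤ) := by
  simp only [residue, betaNum]
  congr 1
  ring

lemma residue_remove (m : ℤ) {lam : YoungDiagram} {k : ℕ} (h : 0 < lam.rowLen k) :
    residue e m (k, lam.rowLen k - 1) = ((betaNum m lam k - 1 : ℤ) : ZMod e) := by
  simp only [residue, betaNum]
  congr 1
  push_cast [show 1 ≤ lam.rowLen k from h]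
  ring

lemma betaSet_eq_of_rowLen {m : ℤ} {lam nu : YoungDiagram} {k : ℕ} {y : ℤ}
    (h : ∀ j ≠ k, nu.rowLen j = lam.rowLen j) (hk : betaNum m nu k = y) :
    betaSet m nu = insert y (betaSet m lam \ {betaNum m lam k}) := by
  have hne : ∀ j ≠ k, betaNum m nu j = betaNum m lam j := fun j hj => by
    simp only [betaNum, h j hj]
  ext x
  constructor
  · rintro ⟨j, rfl⟩
    change betaNum m nu j ∈ _
    rcases eq_or_ne j k with rfl | hj
    · exact Or.inl hk
    · rw [hne j hj]
      exact Or.inr ⟨betaNum_mem m lam j, fun h => hj ((betaNum_strictAnti m lam).injective h)⟩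
  · rintro (rfl | ⟨⟨j, rfl⟩, hj⟩)
    · exact ⟨k, hk⟩
    · have hjk : j ≠ k := fun h => hj (by rw [← h]; rfl)
      exact ⟨j, hne j hjk⟩

lemma exists_addNode (m : ℤ) {lam : YoungDiagram} {k : ℕ}
    (h : betaNum m lam k + 1 ∉ betaSet m lam) :
    ∃ nu, addNode lam (k, lam.rowLen k) = some nu ∧
      betaSet m nu = insert (betaNum m lam k + 1) (betaSet m lam \ {betaNum m lam k}) := by
  have hA := (isAddable_iff m).2 h
  refine ⟨_, by rw [addNode, dif_pos hA], ?_⟩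
  apply betaSet_eq_of_rowLen
  · intro j hj
    refine eq_of_forall_lt_iff fun c => ?_
    rw [← YoungDiagram.mem_iff_lt_rowLen, ← YoungDiagram.mem_iff_lt_rowLen,
      YoungDiagram.mem_mk, Finset.mem_insert, YoungDiagram.mem_cells]
    simp [hj]
  · have : (⟨insert (k, lam.rowLen k) lam.cells, hA.2⟩ : YoungDiagram).rowLen k =
        lam.rowLen k + 1 := by
      refine eq_of_forall_lt_iff fun c => ?_
      rw [← YoungDiagram.mem_iff_lt_rowLen,
        YoungDiagram.mem_mk, Finset.mem_insert, YoungDiagram.mem_cells,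
        YoungDiagram.mem_iff_lt_rowLen, Prod.mk.injEq]
      omega
    simp only [betaNum, this]
    push_cast
    ring

lemma exists_removeNode (m : ℤ) {lam : YoungDiagram} {k : ℕ}
    (h : betaNum m lam k - 1 ∉ betaSet m lam) :
    ∃ nu, removeNode lam (k, lam.rowLen k - 1) = some nu ∧
      betaSet m nu = insert (betaNum m lam k - 1) (betaSet m lam \ {betaNum m lam k}) := by
  have hR := (isRemovable_iff m).2 h
  have hpos := isRemovable_iff_rowLen.1 hR
  refine ⟨_, by rw [removeNode, dif_pos hR], ?_⟩
  apply betaSet_eq_of_rowLen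
  · intro j hj
    refine eq_of_forall_lt_iff fun c => ?_
    rw [← YoungDiagram.mem_iff_lt_rowLen, ← YoungDiagram.mem_iff_lt_rowLen,
      YoungDiagram.mem_mk, Finset.mem_erase, YoungDiagram.mem_cells]
    simp [hj]
  · have : (⟨lam.cells.erase (k, lam.rowLen k - 1), hR.2⟩ : YoungDiagram).rowLen k =
        lam.rowLen k - 1 := by
      refine eq_of_forall_lt_iff fun c => ?_
      rw [← YoungDiagram.mem_iff_lt_rowLen,
        YoungDiagram.mem_mk, Finset.mem_erase, YoungDiagram.mem_cells,
        YoungDiagram.mem_iff_lt_rowLen, Ne, Prod.mk.injEq]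
      omega
    simp only [betaNum, this]
    push_cast [show 1 ≤ lam.rowLen k by omega]
    ring

/-! ### The signature in terms of beta numbers -/

/-- The beta numbers `x` of residue `i` that can be replaced by `x + 1`: the addable `i`-nodes. -/
def addPos (i : ZMod e) (J : Set ℤ) : Set ℤ := {x | (x : ZMod e) = i ∧ x ∈ J ∧ x + 1 ∉ J}

/-- The `x` of residue `i` for which the beta number `x + 1` can be replaced by `x`: the removable
`i`-nodes. -/
def remPos (i : ZMod e) (J : Set ℤ) : Set ℤ := {x | (x : ZMod e) = i ∧ x ∉ J ∧ x + 1 ∈ J}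

/-- All addable `i`-nodes lie in higher rows than all removable ones, so the `i`-signature
has the reduced form `A⋯AR⋯R`. -/
def SignatureSorted (i : ZMod e) (J : Set ℤ) : Prop :=
  ∀ x ∈ addPos i J, ∀ y ∈ remPos i J, y < x

open scoped Classical in
lemma rowLetters_eq (m : ℤ) (i : ZMod e) (lam : YoungDiagram) (k : ℕ) :
    rowLetters e m i lam k =
      (if betaNum m lam k ∈ addPos i (betaSet m lam)
        then [Letter.A (k, lam.rowLen k)] else []) ++
      (if betaNum m lam k - 1 ∈ remPos i (betaSet m lam)
        then [Letter.R (k, lam.rowLen k - 1)] else []) := by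
  unfold rowLetters
  have h1 : (IsAddable lam (k, lam.rowLen k) ∧ residue e m (k, lam.rowLen k) = i) ↔
      betaNum m lam k ∈ addPos i (betaSet m lam) := by
    rw [isAddable_iff m, residue_add]
    have := betaNum_mem m lam k
    simp only [addPos, Set.mem_ofPred_eq]
    tauto
  have h2 : (IsRemovable lam (k, lam.rowLen k - 1) ∧ residue e m (k, lam.rowLen k - 1) = i) ↔
      betaNum m lam k - 1 ∈ remPos i (betaSet m lam) := by
    have h3 : IsRemovable lam (k, lam.rowLen k - 1) → 0 < lam.rowLen k := fun h => by
      have := isRemovable_iff_rowLen.1 h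
      omega
    have h4 := betaNum_mem m lam k
    simp only [remPos, Set.mem_ofPred_eq, sub_add_cancel]
    rw [← isRemovable_iff m]
    constructor
    · rintro ⟨h, h'⟩
      rw [residue_remove m (h3 h)] at h'
      exact ⟨h', h, h4⟩
    · rintro ⟨h', h, -⟩
      refine ⟨h, ?_⟩
      rw [residue_remove m (h3 h), h']
  simp only [h1, h2]

lemma raDeletion_eq_self {l : List Letter}
    (h : l.Pairwise fun a b => ∀ x y, a = Letter.R x → b ≠ Letter.A y) : raDeletion l = l := by
  induction l with
  | nil => rfl
  | cons a l ih =>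
    rw [List.pairwise_cons] at h
    have ih' := ih h.2
    unfold raDeletion at ih' ⊢
    rw [List.foldr_cons, ih']
    match a, l, h with
    | Letter.A x, l, _ => rfl
    | Letter.R x, [], _ => rfl
    | Letter.R x, Letter.R y :: l, _ => rfl
    | Letter.R x, Letter.A y :: l, h => exact absurd rfl (h.1 _ (by simp) x y rfl)

lemma raDeletion_signature {m : ℤ} {i : ZMod e} {lam : YoungDiagram}
    (h : SignatureSorted i (betaSet m lam)) :
    raDeletion (signature e m i lam) = signature e m i lam := by
  classical
  apply raDeletion_eq_self
  unfold signature
  rw [List.pairwise_flatMap]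
  constructor
  · intro k _
    rw [rowLetters_eq]
    split_ifs <;> simp
  · refine List.pairwise_lt_range.imp ?_
    rintro j k hjk a ha b hb x y rfl rfl
    rw [rowLetters_eq] at ha hb
    have h1 : betaNum m lam j - 1 ∈ remPos i (betaSet m lam) := by
      by_contra hn
      rw [if_neg hn] at ha
      split_ifs at ha <;> simp at ha
    have h2 : betaNum m lam k ∈ addPos i (betaSet m lam) := by
      by_contra hn
      rw [if_neg hn] at hb
      split_ifs at hb <;> simp at hb
    have h3 := h _ h2 _ h1
    have h4 := betaNum_strictAnti m lam hjk
    omega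

open scoped Classical in
lemma addableNormal_eq {m : ℤ} {i : ZMod e} {lam : YoungDiagram}
    (h : SignatureSorted i (betaSet m lam)) :
    addableNormal e m i lam = (List.range (lam.colLen 0 + 1)).flatMap fun k =>
      if betaNum m lam k ∈ addPos i (betaSet m lam) then [(k, lam.rowLen k)] else [] := by
  rw [addableNormal, raDeletion_signature h, signature, List.filterMap_flatMap]
  congr 1
  funext k
  rw [rowLetters_eq]
  split_ifs <;> rfl

open scoped Classical in
lemma removableNormal_eq {m : ℤ} {i : ZMod e} {lam : YoungDiagram}
    (h : SignatureSorted i (betaSet m lam)) :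
    removableNormal e m i lam = (List.range (lam.colLen 0 + 1)).flatMap fun k =>
      if betaNum m lam k - 1 ∈ remPos i (betaSet m lam) then [(k, lam.rowLen k - 1)] else [] := by
  rw [removableNormal, raDeletion_signature h, signature, List.filterMap_flatMap]
  congr 1
  funext k
  rw [rowLetters_eq]
  split_ifs <;> rfl

lemma getLast?_flatMap_range {α : Type*} (P : ℕ → Prop) [DecidablePred P] (g : ℕ → α) {n k : ℕ}
    (hk : k < n) (hP : P k) (hmax : ∀ j, k < j → ¬ P j) :
    ((List.range n).flatMap fun j => if P j then [g j] else []).getLast? = some (g k) := by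
  induction n with
  | zero => omega
  | succ n ih =>
    rw [List.range_succ, List.flatMap_append, List.getLast?_append]
    rcases (Nat.lt_succ_iff.1 hk).eq_or_lt with rfl | hkn
    · simp [hP]
    · simp [hmax n hkn, ih hkn]

lemma head?_flatMap_range {α : Type*} (P : ℕ → Prop) [DecidablePred P] (g : ℕ → α) {n k : ℕ}
    (hk : k < n) (hP : P k) (hmin : ∀ j, j < k → ¬ P j) :
    ((List.range n).flatMap fun j => if P j then [g j] else []).head? = some (g k) := by
  induction n with
  | zero => omega
  | succ n ih =>
    rw [List.range_succ, List.flatMap_append, List.head?_append]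
    rcases (Nat.lt_succ_iff.1 hk).eq_or_lt with rfl | hkn
    · have : ((List.range k).flatMap fun j => if P j then [g j] else []) = [] := by
        rw [List.flatMap_eq_nil_iff]
        intro j hj
        rw [if_neg (hmin j (List.mem_range.1 hj))]
      simp [this, hP]
    · simp [ih hkn]

lemma lt_of_betaNum_mem_addPos {m : ℤ} {i : ZMod e} {lam : YoungDiagram} {k : ℕ}
    (h : betaNum m lam k ∈ addPos i (betaSet m lam)) : k < lam.colLen 0 + 1 := by
  by_contra hk
  have h1 := rowLen_eq_zero_iff.2 (show lam.colLen 0 ≤ k by omega)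
  have h2 := rowLen_eq_zero_iff.2 (show lam.colLen 0 ≤ k - 1 by omega)
  refine h.2.2 ⟨k - 1, ?_⟩
  simp only [betaNum, h1, h2]
  push_cast [show 1 ≤ k by omega]
  ring

lemma lt_of_betaNum_mem_remPos {m : ℤ} {i : ZMod e} {lam : YoungDiagram} {k : ℕ}
    (h : betaNum m lam k - 1 ∈ remPos i (betaSet m lam)) : k < lam.colLen 0 := by
  by_contra hk
  have h1 := rowLen_eq_zero_iff.2 (show lam.colLen 0 ≤ k by omega)
  have h2 := rowLen_eq_zero_iff.2 (show lam.colLen 0 ≤ k + 1 by omega)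
  refine h.2.1 ⟨k + 1, ?_⟩
  simp only [betaNum, h1, h2]
  push_cast
  ring

/-! ### The Kashiwara operators in terms of beta numbers -/

lemma exists_fTilde_eq {m : ℤ} {i : ZMod e} {lam : YoungDiagram}
    (h : SignatureSorted i (betaSet m lam)) {x : ℤ} (hx : x ∈ addPos i (betaSet m lam))
    (hmin : ∀ z ∈ addPos i (betaSet m lam), x ≤ z) :
    ∃ nu, fTilde e m i (some lam) = some nu ∧
      betaSet m nu = insert (x + 1) (betaSet m lam \ {x}) := by
  classical
  obtain ⟨k, rfl⟩ := hx.2.1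
  change betaNum m lam k ∈ _ at hx
  have h1 := getLast?_flatMap_range
    (fun k => betaNum m lam k ∈ addPos i (betaSet m lam)) (fun k => (k, lam.rowLen k))
    (lt_of_betaNum_mem_addPos hx) hx (fun j hj hA =>
      absurd ((betaNum_strictAnti m lam) hj) (not_lt.2 (hmin _ hA)))
  obtain ⟨nu, h2, h3⟩ := exists_addNode m hx.2.2
  refine ⟨nu, ?_, h3⟩
  rw [fTilde, Option.bind_some, addableNormal_eq h, h1, Option.bind_some, h2]

lemma exists_eTilde_eq {m : ℤ} {i : ZMod e} {lam : YoungDiagram}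
    (h : SignatureSorted i (betaSet m lam)) {x : ℤ} (hx : x ∈ remPos i (betaSet m lam))
    (hmax : ∀ z ∈ remPos i (betaSet m lam), z ≤ x) :
    ∃ nu, eTilde e m i (some lam) = some nu ∧
      betaSet m nu = insert x (betaSet m lam \ {x + 1}) := by
  classical
  obtain ⟨k, hk⟩ := hx.2.2
  change betaNum m lam k = _ at hk
  obtain rfl : x = betaNum m lam k - 1 := by omega
  have h1 := head?_flatMap_range
    (fun k => betaNum m lam k - 1 ∈ remPos i (betaSet m lam)) (fun k => (k, lam.rowLen k - 1))
    ((lt_of_betaNum_mem_remPos hx).trans (Nat.lt_succ_self _)) hx (fun j hj hR => by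
      have h3 := (betaNum_strictAnti m lam) hj
      have h4 := hmax _ hR
      omega)
  obtain ⟨nu, h2, h3⟩ := exists_removeNode m hx.2.1
  refine ⟨nu, ?_, by rw [h3, sub_add_cancel]⟩
  rw [eTilde, Option.bind_some, removableNormal_eq h, h1, Option.bind_some, h2]

lemma finite_addPos (m : ℤ) (i : ZMod e) (lam : YoungDiagram) :
    (addPos i (betaSet m lam)).Finite := by
  refine ((Set.finite_Iio (lam.colLen 0 + 1)).image (betaNum m lam)).subset ?_
  intro x hx
  obtain ⟨k, rfl⟩ := hx.2.1
  exact ⟨k, lt_of_betaNum_mem_addPos hx, rfl⟩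

lemma finite_remPos (m : ℤ) (i : ZMod e) (lam : YoungDiagram) :
    (remPos i (betaSet m lam)).Finite := by
  refine ((Set.finite_Iio (lam.colLen 0)).image (fun k => betaNum m lam k - 1)).subset ?_
  intro x hx
  obtain ⟨k, hk⟩ := hx.2.2
  change betaNum m lam k = _ at hk
  obtain rfl : x = betaNum m lam k - 1 := by omega
  exact ⟨k, lt_of_betaNum_mem_remPos hx, rfl⟩

section Iteration

variable [Fact (1 < e)]

/-- Adding the lowest addable `i`-node of a sorted signature turns its letter `A` into the
first `R`. -/
lemma addPos_remPos_insert {i : ZMod e} {J : Set ℤ} {x : ℤ} (hx : x ∈ addPos i J) :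
    addPos i (insert (x + 1) (J \ {x})) = addPos i J \ {x} ∧
      remPos i (insert (x + 1) (J \ {x})) = insert x (remPos i J) := by
  have hne : ∀ z : ℤ, (z : ZMod e) = i → z ≠ x + 1 := by
    rintro z hz rfl
    simp [hx.1] at hz
  have hne' : ∀ z : ℤ, (z : ZMod e) = i → z + 1 ≠ x := by
    rintro z hz rfl
    have := hx.1
    simp [hz] at this
  obtain ⟨h1, h2, h3⟩ := hx
  constructor <;> ext z <;> by_cases hz : (z : ZMod e) = i
  · have := hne z hz
    have := hne' z hz
    by_cases hzx : z = x <;> simp_all [addPos]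
  · simp [addPos, hz]
  · have := hne z hz
    have := hne' z hz
    by_cases hzx : z = x <;> simp_all [remPos]
  · have : z ≠ x := fun h => hz (h ▸ h1)
    simp [remPos, hz, this]

/-- Removing the highest removable `i`-node of a sorted signature turns its letter `R` into the
last `A`. -/
lemma addPos_remPos_erase {i : ZMod e} {J : Set ℤ} {x : ℤ} (hx : x ∈ remPos i J) :
    addPos i (insert x (J \ {x + 1})) = insert x (addPos i J) ∧
      remPos i (insert x (J \ {x + 1})) = remPos i J \ {x} := by
  have hne : ∀ z : ℤ, (z : ZMod e) = i → z ≠ x + 1 := by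
    rintro z hz rfl
    simp [hx.1] at hz
  have hne' : ∀ z : ℤ, (z : ZMod e) = i → z + 1 ≠ x := by
    rintro z hz rfl
    have := hx.1
    simp [hz] at this
  obtain ⟨h1, h2, h3⟩ := hx
  constructor <;> ext z <;> by_cases hz : (z : ZMod e) = i
  · have := hne z hz
    have := hne' z hz
    by_cases hzx : z = x <;> simp_all [addPos]
  · have : z ≠ x := fun h => hz (h ▸ h1)
    simp [addPos, hz, this]
  · have := hne z hz
    have := hne' z hz
    by_cases hzx : z = x <;> simp_all [remPos]
  · simp [remPos, hz]

/-- On a sorted signature, `f̃_i` applied once for every letter `A` adds all addable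
`i`-nodes. -/
lemma exists_iterate_fTilde {m : ℤ} {i : ZMod e} (n : ℕ) (lam : YoungDiagram)
    (h : SignatureSorted i (betaSet m lam)) (hn : (addPos i (betaSet m lam)).ncard = n) :
    ∃ nu, (fTilde e m i)^[n] (some lam) = some nu ∧
      betaSet m nu = (betaSet m lam \ addPos i (betaSet m lam)) ∪
        (· + 1) '' addPos i (betaSet m lam) := by
  induction n generalizing lam with
  | zero =>
    rw [Set.ncard_eq_zero (finite_addPos m i lam)] at hn
    exact ⟨lam, rfl, by simp [hn]⟩
  | succ n ih =>
    have hfin := finite_addPos m i lam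
    obtain ⟨x, hx, hmin⟩ := Set.exists_min_image _ id hfin
      (Set.nonempty_of_ncard_ne_zero (by omega))
    obtain ⟨lam', h1, h2⟩ := exists_fTilde_eq h hx hmin
    obtain ⟨h3, h4⟩ := addPos_remPos_insert hx
    rw [← h2] at h3 h4
    have hsort : SignatureSorted i (betaSet m lam') := by
      intro a ha b hb
      rw [h3] at ha
      rw [h4] at hb
      rcases hb with rfl | hb
      · exact lt_of_le_of_ne (hmin a ha.1) fun h => ha.2 h.symm
      · exact h a ha.1 b hb
    obtain ⟨nu, h5, h6⟩ := ih lam' hsort (by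
      rw [h3, Set.ncard_sdiff_singleton_of_mem hx, hn]; rfl)
    refine ⟨nu, by rw [Function.iterate_succ_apply, h1, h5], ?_⟩
    rw [h6, h3, h2]
    have hx1 : x + 1 ∉ addPos i (betaSet m lam) := fun h => by
      have h1 := h.1
      have h2 := hx.1
      simp [h2] at h1
    ext z
    simp only [Set.mem_union, Set.mem_sdiff, Set.mem_insert_iff, Set.mem_singleton_iff,
      Set.mem_image]
    constructor
    · rintro (⟨rfl | hz, hz'⟩ | ⟨y, hy, rfl⟩)
      · exact Or.inr ⟨x, hx, rfl⟩
      · exact Or.inl ⟨hz.1, fun h => hz' ⟨h, hz.2⟩⟩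
      · exact Or.inr ⟨y, hy.1, rfl⟩
    · rintro (⟨hz, hz'⟩ | ⟨y, hy, rfl⟩)
      · exact Or.inl ⟨Or.inr ⟨hz, fun h => hz' (h ▸ hx)⟩, fun h => hz' h.1⟩
      · by_cases hyx : y = x
        · exact Or.inl ⟨Or.inl (by rw [hyx]), fun h => hx1 (hyx ▸ h.1)⟩
        · exact Or.inr ⟨y, ⟨hy, hyx⟩, rfl⟩

/-- On a sorted signature, `ẽ_i` applied once for every letter `R` removes all removable
`i`-nodes. -/
lemma exists_iterate_eTilde {m : ℤ} {i : ZMod e} (n : ℕ) (lam : YoungDiagram)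
    (h : SignatureSorted i (betaSet m lam)) (hn : (remPos i (betaSet m lam)).ncard = n) :
    ∃ nu, (eTilde e m i)^[n] (some lam) = some nu ∧
      betaSet m nu = (betaSet m lam \ (· + 1) '' remPos i (betaSet m lam)) ∪
        remPos i (betaSet m lam) := by
  induction n generalizing lam with
  | zero =>
    rw [Set.ncard_eq_zero (finite_remPos m i lam)] at hn
    exact ⟨lam, rfl, by simp [hn]⟩
  | succ n ih =>
    have hfin := finite_remPos m i lam
    obtain ⟨x, hx, hmax⟩ := Set.exists_max_image _ id hfin
      (Set.nonempty_of_ncard_ne_zero (by omega))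
    obtain ⟨lam', h1, h2⟩ := exists_eTilde_eq h hx hmax
    obtain ⟨h3, h4⟩ := addPos_remPos_erase hx
    rw [← h2] at h3 h4
    have hsort : SignatureSorted i (betaSet m lam') := by
      intro a ha b hb
      rw [h3] at ha
      rw [h4] at hb
      rcases ha with rfl | ha
      · exact lt_of_le_of_ne (hmax b hb.1) fun h => hb.2 h
      · exact h a ha b hb.1
    obtain ⟨nu, h5, h6⟩ := ih lam' hsort (by
      rw [h4, Set.ncard_sdiff_singleton_of_mem hx, hn]; rfl)
    refine ⟨nu, by rw [Function.iterate_succ_apply, h1, h5], ?_⟩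
    rw [h6, h4, h2]
    have hx1 : ∀ y ∈ remPos i (betaSet m lam), y + 1 ≠ x := by
      rintro y hy rfl
      have h1 := hy.1
      have h2 := hx.1
      simp [h1] at h2
    ext z
    simp only [Set.mem_union, Set.mem_sdiff, Set.mem_insert_iff, Set.mem_singleton_iff,
      Set.mem_image, not_exists, not_and]
    constructor
    · rintro (⟨rfl | hz, hz'⟩ | hz)
      · exact Or.inr hx
      · refine Or.inl ⟨hz.1, fun y hy hyz => ?_⟩
        by_cases hyx : y = x
        · exact hz.2 (by rw [← hyz, hyx])
        · exact hz' y ⟨hy, hyx⟩ hyz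
      · exact Or.inr hz.1
    · rintro (⟨hz, hz'⟩ | hz)
      · exact Or.inl ⟨Or.inr ⟨hz, fun h => hz' x hx h.symm⟩, fun y hy => hz' y hy.1⟩
      · by_cases hzx : z = x
        · exact Or.inl ⟨Or.inl hzx, fun y hy hyz => hx1 y hy.1 (hyz.trans hzx)⟩
        · exact Or.inr ⟨hz, hzx⟩

end Iteration

/-! ### The weight as a difference of numbers of nodes -/

/-- The indicator function of a residue. -/
def residueInd (i : ZMod e) (c : ℤ) : ℤ := if (c : ZMod e) = i then 1 else 0

lemma cartan_eq (i : ZMod e) (c : ℤ) :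
    cartan e i (c : ZMod e) =
      2 * residueInd i c - residueInd i (c - 1) - residueInd i (c + 1) := by
  have h1 : ((c - 1 : ℤ) : ZMod e) = i ↔ (c : ZMod e) = i + 1 := by
    push_cast; exact sub_eq_iff_eq_add
  have h2 : ((c + 1 : ℤ) : ZMod e) = i ↔ (c : ZMod e) = i - 1 := by
    push_cast; exact eq_sub_iff_add_eq.symm
  simp only [cartan, residueInd, h1, h2]
  split_ifs <;> rfl

lemma sum_cartan_row (i : ZMod e) (c : ℤ) (n : ℕ) :
    ∑ b ∈ Finset.range n, cartan e i ((c + (b : ℤ) : ℤ) : ZMod e) =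
      residueInd i (c + n - 1) - residueInd i (c + n) + residueInd i c - residueInd i (c - 1) := by
  induction n with
  | zero => simp
  | succ n ih =>
    rw [Finset.sum_range_succ, ih, cartan_eq]
    push_cast
    rw [show c + ((n : ℤ) + 1) - 1 = c + n by ring, show c + ((n : ℤ) + 1) = c + n + 1 by ring]
    ring

lemma wtPairing_eq_sum (m : ℤ) (i : ZMod e) (lam : YoungDiagram) :
    wtPairing e m lam i = ∑ k ∈ Finset.range (lam.colLen 0),
        (residueInd i (betaNum m lam k) - residueInd i (betaNum m lam k - 1)) +
      residueInd i (betaNum m lam (lam.colLen 0)) := by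
  have h1 : ∑ x ∈ lam.cells, cartan e i (residue e m x) =
      ∑ k ∈ Finset.range (lam.colLen 0), ∑ b ∈ Finset.range (lam.rowLen k),
        cartan e i ((m - k + (b : ℤ) : ℤ) : ZMod e) := by
    refine Finset.sum_finset_product _ _ _ ?_
    rintro ⟨k, b⟩
    rw [YoungDiagram.mem_cells, Finset.mem_range, Finset.mem_range,
      ← YoungDiagram.mem_iff_lt_rowLen, ← YoungDiagram.mem_iff_lt_colLen]
    exact ⟨fun h => ⟨lam.up_left_mem le_rfl (Nat.zero_le _) h, h⟩, fun h => h.2⟩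
  have h2 : ∀ n : ℕ, ∑ k ∈ Finset.range n,
      (residueInd i (m - k) - residueInd i (m - k - 1)) =
        residueInd i m - residueInd i (m - n) := by
    intro n
    induction n with
    | zero => simp
    | succ n ih =>
      rw [Finset.sum_range_succ, ih]
      push_cast
      rw [show m - ((n : ℤ) + 1) = m - n - 1 by ring]
      ring
  have h3 : betaNum m lam (lam.colLen 0) = m - (lam.colLen 0 : ℕ) := by
    simp [betaNum, rowLen_eq_zero_iff.2 le_rfl]
  have h4 : (if i = (m : ZMod e) then (1 : ℤ) else 0) = residueInd i m := by
    simp only [residueInd, eq_comm]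
  have h5 := h2 (lam.colLen 0)
  rw [wtPairing, h1, h3, h4]
  simp only [sum_cartan_row]
  have h6 : ∀ k : ℕ, m - k + (lam.rowLen k : ℤ) = betaNum m lam k := fun k => by
    simp only [betaNum]; ring
  simp only [h6, Finset.sum_sub_distrib, Finset.sum_add_distrib] at h5 ⊢
  linarith

open scoped Classical in
lemma sum_residueInd_eq_card (m : ℤ) (i : ZMod e) (lam : YoungDiagram) (n : ℕ) :
    ∑ k ∈ Finset.range n,
        (residueInd i (betaNum m lam k) - residueInd i (betaNum m lam k - 1)) +
      residueInd i (betaNum m lam n) =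
    ((Finset.range (n + 1)).filter fun k => betaNum m lam k ∈ addPos i (betaSet m lam)).card -
    ((Finset.range n).filter fun k => betaNum m lam k - 1 ∈ remPos i (betaSet m lam)).card := by
  have hanti := betaNum_strictAnti m lam
  simp only [Finset.card_filter]
  push_cast
  induction n with
  | zero =>
    have h0 : betaNum m lam 0 + 1 ∉ betaSet m lam := by
      rintro ⟨k, hk⟩
      have h1 : betaNum m lam k = betaNum m lam 0 + 1 := hk
      have := hanti.antitone (Nat.zero_le k)
      omega
    rw [zero_add, Finset.sum_range_zero, Finset.sum_range_one, Finset.sum_range_zero]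
    simp [residueInd, addPos, h0, betaNum_mem]
  | succ n ih =>
    rw [Finset.sum_range_succ, Finset.sum_range_succ _ (n + 1), Finset.sum_range_succ
      (fun k => if betaNum m lam k - 1 ∈ remPos i (betaSet m lam) then (1 : ℤ) else 0) n]
    -- If rows `n` and `n + 1` have equal length, neither gives a letter here, and the two
    -- indicators cancel.
    have key : residueInd i (betaNum m lam (n + 1)) - residueInd i (betaNum m lam n - 1) =
        (if betaNum m lam (n + 1) ∈ addPos i (betaSet m lam) then 1 else 0) -
        (if betaNum m lam n - 1 ∈ remPos i (betaSet m lam) then 1 else 0) := by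
      by_cases heq : betaNum m lam (n + 1) = betaNum m lam n - 1
      · have h1 : betaNum m lam (n + 1) ∉ addPos i (betaSet m lam) := fun h =>
          h.2.2 ⟨n, show betaNum m lam n = _ by omega⟩
        have h2 : betaNum m lam n - 1 ∉ remPos i (betaSet m lam) := fun h =>
          h.2.1 ⟨n + 1, heq⟩
        rw [if_neg h1, if_neg h2, heq]
        ring
      · have hlt := hanti (Nat.lt_add_one n)
        have hgap : ∀ y, betaNum m lam (n + 1) < y → y < betaNum m lam n →
            y ∉ betaSet m lam := by
          rintro _ h1 h2 ⟨k, rfl⟩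
          change betaNum m lam (n + 1) < betaNum m lam k at h1
          change betaNum m lam k < betaNum m lam n at h2
          have h3 := hanti.lt_iff_gt.1 h1
          have h4 := hanti.lt_iff_gt.1 h2
          omega
        have h1 := hgap (betaNum m lam (n + 1) + 1) (by omega) (by omega)
        have h2 := hgap (betaNum m lam n - 1) (by omega) (by omega)
        simp [residueInd, addPos, remPos, h1, h2, betaNum_mem]
    linarith

lemma wtPairing_eq (m : ℤ) (i : ZMod e) (lam : YoungDiagram) :
    wtPairing e m lam i =
      (addPos i (betaSet m lam)).ncard - (remPos i (betaSet m lam)).ncard := by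
  classical
  rw [wtPairing_eq_sum, sum_residueInd_eq_card]
  have hanti := betaNum_strictAnti m lam
  congr 2
  · rw [← Set.ncard_coe_finset, ← Set.ncard_image_of_injective _ hanti.injective]
    congr 1
    ext x
    simp only [Finset.coe_filter, Finset.mem_range, Set.mem_image, Set.mem_ofPred_eq]
    constructor
    · rintro ⟨k, ⟨-, hk⟩, rfl⟩
      exact hk
    · intro hx
      obtain ⟨k, rfl⟩ := hx.2.1
      exact ⟨k, ⟨lt_of_betaNum_mem_addPos hx, hx⟩, rfl⟩
  · rw [← Set.ncard_coe_finset, ← Set.ncard_image_of_injective (f := fun k => betaNum m lam k - 1)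
      _ (fun a b h => hanti.injective (sub_left_injective h))]
    congr 1
    ext x
    simp only [Finset.coe_filter, Finset.mem_range, Set.mem_image, Set.mem_ofPred_eq]
    constructor
    · rintro ⟨k, ⟨-, hk⟩, rfl⟩
      exact hk
    · intro hx
      obtain ⟨k, hk⟩ := hx.2.2
      change betaNum m lam k = _ at hk
      obtain rfl : x = betaNum m lam k - 1 := by omega
      exact ⟨k, ⟨lt_of_betaNum_mem_remPos hx, hx⟩, rfl⟩

/-! ### The action of the affine Weyl group on cores -/

variable [Fact (1 < e)]

local notation "S" => coxeterSystem e

lemma mem_swapPerm_image {i : ZMod e} {J : Set ℤ} {y : ℤ} :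
    y ∈ swapPerm i '' J ↔ swapFun i y ∈ J := by
  constructor
  · rintro ⟨x, hx, rfl⟩
    rwa [swapPerm_apply, swapFun_swapFun]
  · intro h
    exact ⟨_, h, swapFun_swapFun i y⟩

lemma swapPerm_image_of_remPos_eq_empty {i : ZMod e} {J : Set ℤ} (h : remPos i J = ∅) :
    (J \ addPos i J) ∪ (· + 1) '' addPos i J = swapPerm i '' J := by
  have hno : ∀ z : ℤ, (z : ZMod e) = i → z + 1 ∈ J → z ∈ J := by
    intro z hz hz1
    by_contra hzJ
    exact Set.eq_empty_iff_forall_notMem.1 h z ⟨hz, hzJ, hz1⟩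
  ext y
  rw [mem_swapPerm_image]
  have himg : y ∈ (· + 1) '' addPos i J ↔ y - 1 ∈ addPos i J := by
    constructor
    · rintro ⟨x, hx, rfl⟩; simpa using hx
    · intro h; exact ⟨y - 1, h, by simp⟩
  rw [Set.mem_union, himg, Set.mem_sdiff]
  have h1 : ((y - 1 : ℤ) : ZMod e) = i ↔ (y : ZMod e) = i + 1 := by
    push_cast; exact sub_eq_iff_eq_add
  simp only [addPos, Set.mem_ofPred_eq, h1, sub_add_cancel]
  by_cases hy : (y : ZMod e) = i
  · have := hno y hy
    rw [swapFun_of_eq hy]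
    simp only [hy, left_eq_add, one_ne_zero]
    tauto
  by_cases hy' : (y : ZMod e) = i + 1
  · have := hno (y - 1) (h1.2 hy')
    rw [sub_add_cancel] at this
    rw [swapFun_of_eq_add_one hy']
    simp only [hy', add_eq_left, one_ne_zero]
    tauto
  · rw [swapFun_of_ne hy hy']
    simp [hy, hy']

lemma swapPerm_image_of_addPos_eq_empty {i : ZMod e} {J : Set ℤ} (h : addPos i J = ∅) :
    (J \ (· + 1) '' remPos i J) ∪ remPos i J = swapPerm i '' J := by
  have hno : ∀ z : ℤ, (z : ZMod e) = i → z ∈ J → z + 1 ∈ J := by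
    intro z hz hz1
    by_contra hzJ
    exact Set.eq_empty_iff_forall_notMem.1 h z ⟨hz, hz1, hzJ⟩
  ext y
  rw [mem_swapPerm_image]
  have himg : y ∈ (· + 1) '' remPos i J ↔ y - 1 ∈ remPos i J := by
    constructor
    · rintro ⟨x, hx, rfl⟩; simpa using hx
    · intro h; exact ⟨y - 1, h, by simp⟩
  rw [Set.mem_union, Set.mem_sdiff, himg]
  have h1 : ((y - 1 : ℤ) : ZMod e) = i ↔ (y : ZMod e) = i + 1 := by
    push_cast; exact sub_eq_iff_eq_add
  simp only [remPos, Set.mem_ofPred_eq, h1, sub_add_cancel]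
  by_cases hy : (y : ZMod e) = i
  · have := hno y hy
    rw [swapFun_of_eq hy]
    simp only [hy, left_eq_add, one_ne_zero]
    tauto
  by_cases hy' : (y : ZMod e) = i + 1
  · have := hno (y - 1) (h1.2 hy')
    rw [sub_add_cancel] at this
    rw [swapFun_of_eq_add_one hy']
    simp only [hy', add_eq_left, one_ne_zero]
    tauto
  · rw [swapFun_of_ne hy hy']
    simp [hy, hy']

/-- A core cannot have both addable and removable nodes of the same residue, so on cores `s_i` adds
all addable or removes all removable `i`-nodes. -/
lemma exists_simpleAct {m : ℤ} {i : ZMod e} {w : Weyl e} {lam : YoungDiagram}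
    (h : betaSet m lam = orbitSet m w) :
    ∃ nu, simpleAct e m i (some lam) = some nu ∧
      betaSet m nu = orbitSet m ((S).simple i * w) := by
  have hor : remPos i (betaSet m lam) = ∅ ∨ addPos i (betaSet m lam) = ∅ := by
    by_contra hno
    push Not at hno
    obtain ⟨⟨y, hy1, hy2, hy3⟩, ⟨x, hx1, hx2, hx3⟩⟩ := hno
    rw [h] at hy2 hy3 hx2 hx3
    have h1 := lt_of_mem_of_notMem_orbitSet (hx1.trans hy1.symm) hx2 hy2
    have h2 := lt_of_mem_of_notMem_orbitSet (by push_cast; rw [hx1, hy1]) hy3 hx3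
    omega
  have hsort : SignatureSorted i (betaSet m lam) := by
    intro x hx y hy
    rcases hor with h0 | h0 <;> simp_all
  rw [orbitSet_simple_mul, ← h, simpleAct, Option.bind_some, wtPairing_eq]
  by_cases hR : remPos i (betaSet m lam) = ∅
  · rw [hR, Set.ncard_empty, if_pos (by simp), ← swapPerm_image_of_remPos_eq_empty hR]
    simpa using exists_iterate_fTilde _ lam hsort rfl
  · have hA := hor.resolve_left hR
    have hpos := (Set.ncard_pos (finite_remPos m i lam)).2 (Set.nonempty_iff_ne_empty.2 hR)
    rw [hA, Set.ncard_empty, if_neg (by push_cast; omega),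
      ← swapPerm_image_of_addPos_eq_empty hA]
    simpa using exists_iterate_eTilde _ lam hsort rfl

lemma exists_wordAct (m : ℤ) (l : List (ZMod e)) :
    ∃ nu, wordAct e m l (some ⊥) = some nu ∧ betaSet m nu = orbitSet m ((S).wordProd l) := by
  induction l with
  | nil => exact ⟨⊥, rfl, by rw [CoxeterSystem.wordProd_nil, orbitSet_one, betaSet_bot]⟩
  | cons i l ih =>
    obtain ⟨lam, h1, h2⟩ := ih
    obtain ⟨nu, h3, h4⟩ := exists_simpleAct (i := i) h2
    refine ⟨nu, ?_, by rw [CoxeterSystem.wordProd_cons, h4]⟩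
    rw [wordAct, List.foldr_cons]
    rw [wordAct] at h1
    rw [h1, h3]

/-- The partition `w ∅_m` is the one whose beta numbers are the image of the half line under
`w`. -/
theorem isTranslate_iff {m : ℤ} {w : Weyl e} {nu : YoungDiagram} :
    IsTranslate e m w ⊥ nu ↔ betaSet m nu = orbitSet m w := by
  constructor
  · rintro ⟨l, rfl, hl⟩
    obtain ⟨nu', h1, h2⟩ := exists_wordAct m l
    rw [hl, Option.some.injEq] at h1
    rw [h1, h2]
  · intro h
    obtain ⟨l, rfl⟩ := (S).wordProd_surjective w
    obtain ⟨nu', h1, h2⟩ := exists_wordAct m l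
    exact ⟨l, rfl, by rw [h1, betaSet_injective m (h.trans h2.symm)]⟩

lemma exists_betaSet_eq (m : ℤ) (w : Weyl e) : ∃ nu, betaSet m nu = orbitSet m w := by
  obtain ⟨l, rfl⟩ := (S).wordProd_surjective w
  obtain ⟨nu, -, h⟩ := exists_wordAct m l
  exact ⟨nu, h⟩

lemma isRestricted_of_betaSet_eq {m : ℤ} {w : Weyl e} {nu : YoungDiagram}
    (h : betaSet m nu = orbitSet m w) : IsRestricted e nu := by
  intro k
  have h1 := betaNum_mem m nu k
  rw [h] at h1
  have h2 := sub_mem_orbitSet h1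
  rw [← h] at h2
  obtain ⟨j, hj⟩ := h2
  have hj' : betaNum m nu j = betaNum m nu k - e := hj
  have he : (1 : ℤ) < e := by exact_mod_cast (Fact.out : 1 < e)
  have hkj : k < j := (betaNum_strictAnti m nu).lt_iff_gt.1 (by omega)
  have h3 := (betaNum_strictAnti m nu).antitone (show k + 1 ≤ j from hkj)
  simp only [betaNum, Nat.cast_succ] at hj' h3
  omega

end AffineCrystal

namespace AffineCrystal

variable {e : ℕ} [Fact (1 < e)]

local notation "S" => coxeterSystem e

/-! ### Bruhat order on minimal coset representatives and containment of cores -/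

lemma IsDistinguished.affPerm_lt {c : ZMod e} {w : Weyl e} (hw : IsDistinguished e c w) {x : ℤ}
    (hx : (x : ZMod e) ≠ c) : affPerm e w x < affPerm e w (x + 1) := by
  rw [affPerm_lt_iff_length_lt w _ x rfl]
  exact lt_of_le_of_ne (hw _ (Subgroup.subset_closure ⟨_, hx, rfl⟩))
    ((S).length_mul_simple_ne w _).symm

/-- If `u` is increasing at all residues but that of `m`, it lies below `v` in the Bruhat order as
soon as its core is contained in that of `v`.  The induction removes a left descent `s_i`
of `v`, and with it the removable `i`-nodes of the smaller core, if any. -/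
theorem bruhatLE_of_dominated {m : ℤ} (v u : Weyl e)
    (hu : ∀ x : ℤ, (x : ZMod e) ≠ m → affPerm e u x < affPerm e u (x + 1))
    (h : Dominated (orbitSet m u) (orbitSet m v)) : BruhatLE e u v := by
  induction hn : (S).length v using Nat.strong_induction_on generalizing v u with
  | _ n ih =>
  subst hn
  rcases eq_or_ne v 1 with rfl | hv
  · obtain ⟨nu, hnu⟩ := exists_betaSet_eq m u
    rw [orbitSet_one, ← hnu, ← betaSet_bot, ← le_iff_dominated, le_bot_iff] at h
    rw [h, betaSet_bot] at hnu
    have h1 : u = 1 := by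
      refine eq_one_of_forall_lt u fun x => ?_
      by_cases hx : (x : ZMod e) = m
      · refine affPerm_lt_congr u hx ?_
        have h2 : affPerm e u m ∈ Set.Iic m := hnu ▸ apply_mem_orbitSet.2 le_rfl
        have h3 : affPerm e u (m + 1) ∉ Set.Iic m := fun h => by
          rw [hnu, apply_mem_orbitSet] at h
          omega
        rw [Set.mem_Iic] at h2 h3
        omega
      · exact hu x hx
    rw [h1]
    exact Relation.ReflTransGen.refl
  obtain ⟨i, hi⟩ := (S).exists_leftDescent_of_ne_one hv
  have hle := bruhatLE_of_simple_mul_lt hi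
  by_cases hmin : ∀ z : ℤ, (z : ZMod e) = i → z + 1 ∈ orbitSet m u → z ∈ orbitSet m u
  · refine (ih _ hi ((S).simple i * v) u hu ?_ rfl).trans hle
    refine dominated_of_forall_ne (bddAbove_orbitSet m _) (bddAbove_orbitSet m _) hmin ?_
    intro y hy
    rw [orbitSet_simple_mul, countAbove_swapPerm_image _ hy]
    exact h y
  · push Not at hmin
    obtain ⟨z, hz, hz1, hz0⟩ := hmin
    have h1 : BruhatLE e ((S).simple i * u) ((S).simple i * v) := by
      refine ih _ hi _ _ ?_ ?_ rfl
      · intro x hx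
        rw [affPerm_mul, affPerm_mul, affPerm_simple, affPerm_simple]
        refine lt_of_le_of_ne (not_lt.1 fun hlt => ?_)
          fun heq => absurd ((affPerm e u).injective ((swapPerm i).injective heq)) (by omega)
        obtain ⟨h2, h3⟩ := swapFun_lt_swapFun (hu x hx) hlt
        obtain ⟨k, hk⟩ := exists_eq_add_mul (hz.trans h3.symm)
        rw [hk, ← affPerm_add_mul, apply_mem_orbitSet] at hz0
        rw [hk, add_right_comm, ← h2, ← affPerm_add_mul, apply_mem_orbitSet] at hz1
        omega
      · refine dominated_of_forall_ne (i := i) (bddAbove_orbitSet m _) (bddAbove_orbitSet m _) ?_ ?_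
        · intro y hy
          rw [orbitSet_simple_mul, mem_swapPerm_image, mem_swapPerm_image, swapFun_of_eq hy,
            swapFun_of_eq_add_one (by simp [hy]), add_sub_cancel_right]
          intro hyK
          by_contra hyK1
          have h2 := lt_of_mem_of_notMem_orbitSet (hy.trans hz.symm) hyK hz0
          have h3 := lt_of_mem_of_notMem_orbitSet (by push_cast; rw [hy, hz]) hz1 hyK1
          omega
        · intro y hy
          rw [orbitSet_simple_mul, orbitSet_simple_mul, countAbove_swapPerm_image _ hy,
            countAbove_swapPerm_image _ hy]
          exact h y
    have h2 := h1.simple_mul i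
    rw [(S).simple_mul_simple_cancel_left, (S).simple_mul_simple_cancel_left] at h2
    rcases h2 with h2 | h2
    · exact h2.trans hle
    · exact h2

theorem bruhatLE_iff_le {m : ℤ} {u v : Weyl e} (hu : IsDistinguished e (m : ZMod e) u)
    {lam mu : YoungDiagram} (hlam : betaSet m lam = orbitSet m v)
    (hmu : betaSet m mu = orbitSet m u) : BruhatLE e u v ↔ mu ≤ lam := by
  rw [le_iff_dominated m, hlam, hmu]
  exact ⟨fun h => h.dominated m, bruhatLE_of_dominated v u fun x hx => hu.affPerm_lt hx⟩

/-! ### The longest element of a maximal parabolic subgroup -/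

lemma affPerm_le_iff_of_mem_parabolic {c : ℤ} {u : Weyl e} (hu : u ∈ parabolic e (c : ZMod e))
    (x : ℤ) : affPerm e u x ≤ c ↔ x ≤ c := by
  induction hu using Subgroup.closure_induction generalizing x with
  | mem u hu =>
    obtain ⟨i, hi, rfl⟩ := hu
    rw [affPerm_simple, swapFun]
    split_ifs with h1 h2
    · have : x ≠ c := fun h => hi (by rw [← h1, h])
      omega
    · have : x - 1 ≠ c := fun h => hi (by rw [← h]; push_cast; rw [h2]; ring)
      omega
    · rfl
  | one => simp
  | mul u v _ _ hu hv => rw [affPerm_mul, hu, hv]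
  | inv u _ hu =>
    rw [← hu (affPerm e u⁻¹ x), ← affPerm_mul]
    simp

lemma IsLongest.affPerm_eq {w₀ : Weyl e} (hw₀ : IsLongest e 0 w₀) {x : ℤ} (h0 : 0 < x)
    (hx : x ≤ e) : affPerm e w₀ x = e + 1 - x := by
  have hdesc : ∀ y : ℤ, 0 < y → y < e → affPerm e w₀ (y + 1) < affPerm e w₀ y := by
    intro y hy0 hye
    have hy : (y : ZMod e) ≠ 0 := by
      rw [Ne, ZMod.intCast_zmod_eq_zero_iff_dvd]
      intro h
      have := Int.le_of_dvd hy0 h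
      omega
    have h1 := hw₀.2 _ (mul_mem hw₀.1 (Subgroup.subset_closure ⟨_, hy, rfl⟩))
    have h2 := mt (affPerm_lt_iff_length_lt w₀ _ y rfl).1 (not_lt.2 h1)
    have h3 : affPerm e w₀ y ≠ affPerm e w₀ (y + 1) := fun h => by
      have := (affPerm e w₀).injective h
      omega
    omega
  have hpos : ∀ y : ℤ, 0 < y → 0 < affPerm e w₀ y := by
    intro y hy
    have := affPerm_le_iff_of_mem_parabolic (c := 0) (by simpa using hw₀.1) y
    omega
  have hle : ∀ y : ℤ, y ≤ e → affPerm e w₀ y ≤ e := by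
    intro y hy
    exact (affPerm_le_iff_of_mem_parabolic (c := e) (by simpa using hw₀.1) y).2 hy
  have hup : ∀ n : ℕ, (n : ℤ) + 1 ≤ e → affPerm e w₀ (n + 1) ≤ e - n := by
    intro n
    induction n with
    | zero => intro h; simpa using hle 1 (by simpa using h)
    | succ n ih =>
      intro h
      push_cast at h ⊢
      have := ih (by omega)
      have := hdesc (n + 1) (by omega) (by omega)
      omega
  have hdown : ∀ n : ℕ, (n : ℤ) + 1 ≤ e → (n : ℤ) + 1 ≤ affPerm e w₀ (e - n) := by
    intro n
    induction n with
    | zero =>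
      intro h
      have := hpos e (by push_cast at h; omega)
      simpa using Int.add_one_le_iff.2 this
    | succ n ih =>
      intro h
      push_cast at h ⊢
      have h1 := ih (by omega)
      have h2 := hdesc (e - (n + 1)) (by omega) (by omega)
      rw [show (e : ℤ) - (n + 1) + 1 = e - n by ring] at h2
      omega
  have h1 := hup (x - 1).toNat (by omega)
  have h2 := hdown (e - x).toNat (by omega)
  rw [Int.toNat_of_nonneg (by omega)] at h1 h2
  rw [show x - 1 + 1 = x by ring] at h1
  rw [show (e : ℤ) - (e - x) = x by ring] at h2
  omega

lemma IsLongest.orbitSet_eq {w₀ : Weyl e} (hw₀ : IsLongest e 0 w₀) {m : ℕ} (hm : m < e) :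
    orbitSet m w₀ = Set.Iic 0 ∪ Set.Ioc ((e : ℤ) - m) e := by
  ext x
  obtain ⟨y, rfl⟩ := (affPerm e w₀).surjective x
  rw [apply_mem_orbitSet, Set.mem_union, Set.mem_Iic, Set.mem_Ioc]
  have h1 := affPerm_le_iff_of_mem_parabolic (c := 0) (by simpa using hw₀.1) y
  have h2 := affPerm_le_iff_of_mem_parabolic (u := w₀) (c := e) (by simpa using hw₀.1) y
  by_cases hy : 0 < y ∧ y ≤ e
  · rw [hw₀.affPerm_eq hy.1 hy.2]
    omega
  · omega

/-! ### Runners -/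

lemma IsDistinguished.affPerm_lt_of_lt {w : Weyl e} (hw : IsDistinguished e 0 w) {x y : ℤ}
    (hx : -(e : ℤ) < x) (hxy : x < y) (hy : y ≤ 0) : affPerm e w x < affPerm e w y := by
  have hstep : ∀ z : ℤ, -(e : ℤ) < z → z < 0 → affPerm e w z < affPerm e w (z + 1) := by
    intro z h1 h2
    refine hw.affPerm_lt ?_
    rw [Ne, ZMod.intCast_zmod_eq_zero_iff_dvd, ← Int.dvd_neg]
    intro h
    have := Int.le_of_dvd (by omega) h
    omega
  induction y, (show x + 1 ≤ y from hxy) using Int.leInduction with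
  | base => exact hstep x hx (by omega)
  | succ y hxy' ih => exact (ih (by omega) (by omega)).trans (hstep y (by omega) (by omega))

lemma runnerMax_orbitSet (w : Weyl e) {j : ℤ} (hj : -(e : ℤ) < j) (hj0 : j ≤ 0) :
    runnerMax e (orbitSet 0 w) ((affPerm e w j : ℤ) : ZMod e) = affPerm e w j := by
  refine IsGreatest.csSup_eq ⟨⟨apply_mem_orbitSet.2 hj0, rfl⟩, ?_⟩
  rintro x ⟨hx, hxj⟩
  obtain ⟨k, rfl⟩ := exists_eq_add_mul hxj
  rw [← affPerm_add_mul, apply_mem_orbitSet] at hx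
  have he : (0 : ℤ) < e := by have := (Fact.out : 1 < e); omega
  have hk : k ≤ 0 := by
    by_contra hk
    have : 1 * (e : ℤ) ≤ k * e := mul_le_mul_of_nonneg_right (by omega) he.le
    omega
  have := mul_nonpos_of_nonpos_of_nonneg hk he.le
  omega

lemma exists_affPerm_cast_eq (w : Weyl e) (i : ZMod e) :
    ∃ j : ℤ, -(e : ℤ) < j ∧ j ≤ 0 ∧ ((affPerm e w j : ℤ) : ZMod e) = i := by
  obtain ⟨x, rfl⟩ := ZMod.intCast_surjective i
  obtain ⟨y, rfl⟩ := (affPerm e w).surjective x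
  have he : (0 : ℤ) < e := by have := (Fact.out : 1 < e); omega
  have h1 := Int.emod_nonneg (-y) he.ne'
  have h2 := Int.emod_lt_of_pos (-y) he
  refine ⟨-((-y) % e), by omega, by omega, ?_⟩
  rw [affPerm_cast_eq_iff]
  push_cast
  simp

lemma IsDistinguished.ncard_runnerMax_lt {w : Weyl e} (hw : IsDistinguished e 0 w) {j : ℤ}
    (hj : -(e : ℤ) < j) (hj0 : j ≤ 0) :
    {i : ZMod e | affPerm e w j < runnerMax e (orbitSet 0 w) i}.ncard = (-j).toNat := by
  have himg : {i : ZMod e | affPerm e w j < runnerMax e (orbitSet 0 w) i} =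
      (fun k : ℤ => ((affPerm e w k : ℤ) : ZMod e)) '' Set.Ioc j 0 := by
    ext i
    obtain ⟨k, hk, hk0, rfl⟩ := exists_affPerm_cast_eq w i
    rw [Set.mem_ofPred_eq, runnerMax_orbitSet w hk hk0]
    constructor
    · intro h
      refine ⟨k, ⟨?_, hk0⟩, rfl⟩
      by_contra hkj
      rcases (not_lt.1 hkj).eq_or_lt with rfl | hlt
      · exact lt_irrefl _ h
      · exact absurd (hw.affPerm_lt_of_lt hk hlt hj0) (not_lt.2 h.le)
    · rintro ⟨k', ⟨hk', hk0'⟩, heq⟩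
      have h1 := runnerMax_orbitSet w (show -(e : ℤ) < k' by omega) hk0'
      have h2 := runnerMax_orbitSet w hk hk0
      simp only at heq
      rw [← h2, ← heq, h1]
      exact hw.affPerm_lt_of_lt hj hk' hk0'
  have hinj : Set.InjOn (fun k : ℤ => ((affPerm e w k : ℤ) : ZMod e)) (Set.Ioc j 0) := by
    rintro a ⟨ha, ha0⟩ b ⟨hb, hb0⟩ hab
    have h1 := runnerMax_orbitSet w (show -(e : ℤ) < a by omega) ha0
    have h2 := runnerMax_orbitSet w (show -(e : ℤ) < b by omega) hb0
    simp only at hab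
    rw [hab, h2] at h1
    exact ((affPerm e w).injective h1).symm
  rw [himg, hinj.ncard_image, ← Finset.coe_Ioc, Set.ncard_coe_finset, Int.card_Ioc,
    zero_sub]

/-- The highest elements of the runners of `w {x | x ≤ 0}` are `w 0 > w (-1) > ⋯ > w (1 - e)`, so
`τ_m` adjoins the images of the last `m` elements of `1, …, e`. -/
lemma IsDistinguished.tauSet_orbitSet {w : Weyl e} (hw : IsDistinguished e 0 w) {m : ℕ}
    (hm : m < e) :
    tauSet e m (orbitSet 0 w) = affPerm e w '' (Set.Iic 0 ∪ Set.Ioc ((e : ℤ) - m) e) := by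
  rw [Set.image_union, tauSet]
  congr 1
  ext y
  constructor
  · rintro ⟨i, hi, rfl⟩
    obtain ⟨j, hj, hj0, rfl⟩ := exists_affPerm_cast_eq w i
    rw [runnerMax_orbitSet w hj hj0] at hi ⊢
    rw [hw.ncard_runnerMax_lt hj hj0] at hi
    exact ⟨j + e, ⟨by omega, by omega⟩, affPerm_add w j⟩
  · rintro ⟨x, ⟨hx, hxe⟩, rfl⟩
    have hj : -(e : ℤ) < x - e := by omega
    have hj0 : x - e ≤ 0 := by omega
    refine ⟨((affPerm e w (x - e) : ℤ) : ZMod e), ?_, ?_⟩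
    · rw [runnerMax_orbitSet w hj hj0, hw.ncard_runnerMax_lt hj hj0]
      omega
    · rw [runnerMax_orbitSet w hj hj0, ← affPerm_add, sub_add_cancel]

lemma tauSet_orbitSet_eq {w w₀ : Weyl e} (hw : IsDistinguished e 0 w) (hw₀ : IsLongest e 0 w₀)
    {m : ℕ} (hm : m < e) : tauSet e m (orbitSet 0 w) = orbitSet m (w * w₀) := by
  rw [orbitSet_mul, hw₀.orbitSet_eq hm, hw.tauSet_orbitSet hm]

end AffineCrystal

theorem mainTheorem7 (e : ℕ) (he : 2 ≤ e) (m : ℕ) (hm : m < e)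
    (w w' w₀ : AffineCrystal.Weyl e)
    (hw : AffineCrystal.IsDistinguished e 0 w)
    (hw' : AffineCrystal.IsDistinguished e (m : ZMod e) w')
    (hw₀ : AffineCrystal.IsLongest e 0 w₀)
    (lam mu : YoungDiagram)
    (hlam : AffineCrystal.IsTranslate e 0 w ⊥ lam)
    (hmu : AffineCrystal.IsTranslate e (m : ℤ) w' ⊥ mu) :
    (AffineCrystal.betaSet (m : ℤ) (AffineCrystal.tau e m lam) =
        AffineCrystal.tauSet e m (AffineCrystal.betaSet 0 lam) ∧
      AffineCrystal.IsRestricted e (AffineCrystal.tau e m lam)) ∧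
    (AffineCrystal.BruhatLE e w' (w * w₀) ↔ mu ≤ AffineCrystal.tau e m lam) ∧
    (∀ nu : YoungDiagram,
      AffineCrystal.IsTranslate e (m : ℤ) (w * w₀) ⊥ nu ↔ nu = AffineCrystal.tau e m lam) := by
  have : Fact (1 < e) := ⟨he⟩
  have h0 := AffineCrystal.isTranslate_iff.1 hlam
  have hJ : AffineCrystal.tauSet e m (AffineCrystal.betaSet 0 lam) =
      AffineCrystal.orbitSet m (w * w₀) := by
    rw [h0, AffineCrystal.tauSet_orbitSet_eq hw hw₀ hm]
  have htau : AffineCrystal.betaSet (m : ℤ) (AffineCrystal.tau e m lam) =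
      AffineCrystal.tauSet e m (AffineCrystal.betaSet 0 lam) := by
    have hex : ∃ nu : YoungDiagram, AffineCrystal.betaSet (m : ℤ) nu =
        AffineCrystal.tauSet e m (AffineCrystal.betaSet 0 lam) := by
      rw [hJ]
      exact AffineCrystal.exists_betaSet_eq _ _
    rw [AffineCrystal.tau, dif_pos hex]
    exact hex.choose_spec
  have htau' := htau.trans hJ
  refine ⟨⟨htau, AffineCrystal.isRestricted_of_betaSet_eq htau'⟩,
    AffineCrystal.bruhatLE_iff_le (by simpa using hw') htau' (AffineCrystal.isTranslate_iff.1 hmu),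
    fun nu => ?_⟩
  rw [AffineCrystal.isTranslate_iff, ← htau']
  exact (AffineCrystal.betaSet_injective _).eq_iff
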